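/- Let $\mathbb K=\mathbb R$ or $\mathbb C$. Consider an autonomous quad-graph equation $$u_{i+1,j+1}=F(u_{i,j},u_{i+1,j},u_{i,j+1}),\qquad (i,j)\in\mathbb Z^2,$$ where $F$ is analytic on an open set $D\subseteq\mathbb K^3$, its three partial derivatives do not vanish on $D$, and the equation is uniquely solvable for each argument of the right-hand side (the value of $F$ and two of its arguments determine the third one within $D$). Write $u_{p,q}$ for $u_{i+p,j+q}$ and $u=u_{0,0}$. Let $\Omega$ be a set of solutions $\mathbb Z^2\to\mathbb K$ of the equation (all of whose triples $(u_{i,j},u_{i+1,j},u_{i,j+1})$ lie in $D$) that is invariant under all shifts of $\mathbb Z^2$ and such that, for every $N$, the tuple of dynamical variables $u_{k,0},u_{0,l}$ with $|k|,|l|\le N$ ranges over a non-empty connected open set when $u$ ranges over $\Omega$. (For example, $\Omega$ may be the set of all $U$-valued solutions if $U\subseteq\mathbb K$ is open and connected, $D=U^3$, and $F:U^3\to U$ is bijective onto $U$ in each argument.) A function $g[u]$ is a quotient of two analytic functions, with non-zero denominator, of finitely many dynamical variables $u_{k,0}$, $u_{0,l}$, $u\in\Omega$; these functions form a field. A function $f[i,j,u]$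 is a family of such functions indexed by $(i,j)\in\mathbb Z^2$, depending on a finite set of dynamical variables that is the same for all $i,j$. The shifts $T_i,T_j$ in $i$ and $j$ by virtue of the equation act on these functions: $T_i$ replaces $i$ by $i+1$ and $u_{p,q}$ by $u_{p+1,q}$, $T_j$ replaces $j$ by $j+1$ and $u_{p,q}$ by $u_{p,q+1}$, where mixed shifts $u_{p,q}$, $pq\ne0$, are expressed through the dynamical variables. Put $$L=T_iT_j-F_{u_{1,0}}T_i-F_{u_{0,1}}T_j-F_u .$$ A function $f[i,j,u]$ is a symmetry if $L(f)=0$ for all $i,j$. An $i$-symmetry driver is an operator $R=\sum_{k=0}^{r}\lambda_k[u]T_i^k$, $r\ge0$, $\lambda_r\neq0$, such that $R(\xi)$ is a symmetry for every function $\xi[i,j,u]$ with $T_j(\xi)=\xi$. A formal $i$-integral is an operator $\mathcal I=\sum_{k=0}^{m}\mu_k[u]T_i^k$, $m>0$, $\mu_m\ne0$, for which there are functions $\nu_0[u],\dots,\nu_{m-1}[u]$ with the operator identity $(T_j-1)\,\mathcal I=\sum_{k=0}^{m-1}\nu_k[u]\,T_i^k L$. The $j$-symmetry drivers and the formal $j$-integrals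 are defined by interchanging $i$ and $j$. Theorem. The equation admits both a formal $i$-integral and a formal $j$-integral if and only if it admits both an $i$-symmetry driver and a $j$-symmetry driver. -/

import Mathlib

noncomputable section

open scoped Topology ContDiff

namespace QuadGraph

/-- The partial derivative in `u` of a function of three scalar arguments `(u, u₁₀, u₀₁)`. -/
def partialU {𝕜 : Type*} [RCLike 𝕜] (F : 𝕜 × 𝕜 × 𝕜 → 𝕜) (p : 𝕜 × 𝕜 × 𝕜) : 𝕜 :=
  fderiv 𝕜 F p (1, 0, 0)

/-- The partial derivative in `u₁₀` of a function of `(u, u₁₀, u₀₁)`. -/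
def partialU10 {𝕜 : Type*} [RCLike 𝕜] (F : 𝕜 × 𝕜 × 𝕜 → 𝕜) (p : 𝕜 × 𝕜 × 𝕜) : 𝕜 :=
  fderiv 𝕜 F p (0, 1, 0)

/-- The partial derivative in `u₀₁` of a function of `(u, u₁₀, u₀₁)`. -/
def partialU01 {𝕜 : Type*} [RCLike 𝕜] (F : 𝕜 × 𝕜 × 𝕜 → 𝕜) (p : 𝕜 × 𝕜 × 𝕜) : 𝕜 :=
  fderiv 𝕜 F p (0, 0, 1)

/-- An autonomous quad-graph equation `u₁₁ = F(u, u₁₀, u₀₁)`: the right-hand side `F` is analytic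
on an open domain, its three partial derivatives do not vanish there, and the equation is uniquely
solvable for each argument of the right-hand side (a value of `u₁₁` together with two of the
arguments determines the third one). -/
structure Equation (𝕜 : Type*) [RCLike 𝕜] where
  F : 𝕜 × 𝕜 × 𝕜 → 𝕜
  dom : Set (𝕜 × 𝕜 × 𝕜)
  isOpen_dom : IsOpen dom
  analytic : AnalyticOnNhd 𝕜 F dom
  partialU_ne_zero : ∀ p ∈ dom, partialU F p ≠ 0
  partialU10_ne_zero : ∀ p ∈ dom, partialU10 F p ≠ 0
  partialU01_ne_zero : ∀ p ∈ dom, partialU01 F p ≠ 0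
  unique_u : ∀ x x' y z, (x, y, z) ∈ dom → (x', y, z) ∈ dom → F (x, y, z) = F (x', y, z) → x = x'
  unique_u10 : ∀ x y y' z, (x, y, z) ∈ dom → (x, y', z) ∈ dom → F (x, y, z) = F (x, y', z) → y = y'
  unique_u01 : ∀ x y z z', (x, y, z) ∈ dom → (x, y, z') ∈ dom → F (x, y, z) = F (x, y, z') → z = z'

/-- The triple `(u₀₀, u₁₀, u₀₁)` of values of a lattice function at the quad with corner `s`. -/
def corner {𝕜 : Type*} (u : ℤ × ℤ → 𝕜) (s : ℤ × ℤ) : 𝕜 × 𝕜 × 𝕜 :=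
  (u s, u (s + (1, 0)), u (s + (0, 1)))

/-- Solutions of the equation on the whole lattice `ℤ × ℤ`. -/
def Equation.IsSolution {𝕜 : Type*} [RCLike 𝕜] (E : Equation 𝕜) (u : ℤ × ℤ → 𝕜) : Prop :=
  ∀ s : ℤ × ℤ, corner u s ∈ E.dom ∧ u (s + (1, 1)) = E.F (corner u s)

/-- The lattice points `(k, 0)` and `(0, l)` with `|k|, |l| ≤ N`. The values of `u` there are the
dynamical variables `u_{k,0}`, `u_{0,l}`. -/
def cross (N : ℕ) : Finset (ℤ × ℤ) :=
  Finset.Icc (-(N : ℤ)) N ×ˢ {0} ∪ {0} ×ˢ Finset.Icc (-(N : ℤ)) N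

/-- The tuple of the dynamical variables `u_{k,0}`, `u_{0,l}`, `|k|, |l| ≤ N`, of `u`. -/
def dynVars {𝕜 : Type*} (N : ℕ) (u : ℤ × ℤ → 𝕜) : cross N → 𝕜 := fun s => u s

/-- The shift of a lattice function by the vector `v`. -/
def translate {𝕜 : Type*} (v : ℤ × ℤ) (u : ℤ × ℤ → 𝕜) : ℤ × ℤ → 𝕜 := fun s => u (s + v)

/-- A domain on which the calculus of functions of the dynamical variables takes place: a set of
solutions which is invariant under all shifts and in which any finite collection of dynamical
variables ranges over a non-empty connected open set (so that the dynamical variables are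
independent and a product of non-zero analytic functions of them is non-zero). When `F` is defined
on `U × U × U` and can be solved globally, it may be the set of all `U`-valued solutions. -/
structure SolutionSpace {𝕜 : Type*} [RCLike 𝕜] (E : Equation 𝕜) where
  carrier : Set (ℤ × ℤ → 𝕜)
  isSolution : ∀ u ∈ carrier, E.IsSolution u
  translate_mem : ∀ v, ∀ u ∈ carrier, translate v u ∈ carrier
  isOpen_dynVars : ∀ N, IsOpen (dynVars N '' carrier)
  isConnected_dynVars : ∀ N, IsConnected (dynVars N '' carrier)

section Coordinates

variable {𝕜 : Type*} [RCLike 𝕜]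

lemma analyticAt_of_implicit {V : Type*} [NormedAddCommGroup V] [NormedSpace 𝕜 V]
    [CompleteSpace V] {Ψ : V × 𝕜 → 𝕜} {f : V → 𝕜} {x : V}
    (hΨ : AnalyticAt 𝕜 Ψ (x, f x)) (hd : fderiv 𝕜 Ψ (x, f x) (0, 1) ≠ 0)
    (h0 : ∀ᶠ v in 𝓝 (x, f x), Ψ v = Ψ (x, f x) → v.2 = f v.1) : AnalyticAt 𝕜 f x := by
  have hc : ContDiffAt 𝕜 ω Ψ (x, f x) := hΨ.contDiffAt
  have hn : (ω : WithTop ℕ∞) ≠ 0 := by simp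
  have hi : (fderiv 𝕜 Ψ (x, f x) ∘L .inr 𝕜 V 𝕜).IsInvertible := by
    refine ⟨ContinuousLinearEquiv.unitsEquivAut 𝕜 (Units.mk0 _ hd), ?_⟩
    ext
    simp
  have han := (hc.contDiffAt_implicitFunction hn hi).analyticAt
  have hself := hc.implicitFunction_apply_self hn hi
  have hev := hc.eventually_apply_implicitFunction hn hi
  refine han.congr ?_
  have ht : Filter.Tendsto (fun y => (y, hc.implicitFunction hn hi y)) (𝓝 x) (𝓝 (x, f x)) := by
    have : ContinuousAt (fun y => (y, hc.implicitFunction hn hi y)) x :=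
      continuousAt_id.prodMk han.continuousAt
    have h2 := this.tendsto
    simp only at hself
    rwa [hself] at h2
  filter_upwards [hev, ht.eventually h0] with y h1 h2
  exact h2 h1

lemma Equation.analyticOnNhd_solve (E : Equation 𝕜) {V : Type*} [NormedAddCommGroup V]
    [NormedSpace 𝕜 V] [CompleteSpace V] {e : 𝕜 × 𝕜 × 𝕜}
    (hd : ∀ p ∈ E.dom, fderiv 𝕜 E.F p e ≠ 0)
    (hu : ∀ (p : 𝕜 × 𝕜 × 𝕜) (t s : 𝕜), p + t • e ∈ E.dom → p + s • e ∈ E.dom →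
      E.F (p + t • e) = E.F (p + s • e) → t = s)
    {U : Set V} (hU : IsOpen U) {f d : V → 𝕜} {c : V → 𝕜 × 𝕜 × 𝕜} (hc : AnalyticOnNhd 𝕜 c U)
    (hdn : AnalyticOnNhd 𝕜 d U)
    (h : ∀ x ∈ U, c x + f x • e ∈ E.dom ∧ E.F (c x + f x • e) = d x) :
    AnalyticOnNhd 𝕜 f U := by
  intro x hx
  have hin : AnalyticAt 𝕜 (fun v : V × 𝕜 => c v.1 + v.2 • e) (x, f x) :=
    ((hc x hx).comp_of_eq analyticAt_fst rfl).add (analyticAt_snd.smul analyticAt_const)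
  have hF : AnalyticAt 𝕜 (fun v : V × 𝕜 => E.F (c v.1 + v.2 • e)) (x, f x) :=
    (E.analytic _ (h x hx).1).comp_of_eq hin rfl
  have hΨ : AnalyticAt 𝕜 (fun v : V × 𝕜 => E.F (c v.1 + v.2 • e) - d v.1) (x, f x) :=
    hF.sub ((hdn x hx).comp_of_eq analyticAt_fst rfl)
  refine analyticAt_of_implicit hΨ ?_ ?_
  · have hl : HasDerivAt (fun t : 𝕜 => (x, t)) ((0 : V), (1 : 𝕜)) (f x) :=
      (hasDerivAt_const _ _).prodMk (hasDerivAt_id _)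
    have h1 := hΨ.differentiableAt.hasFDerivAt.comp_hasDerivAt (f x) hl
    have hl2 : HasDerivAt (fun t : 𝕜 => c x + t • e) e (f x) := by
      simpa using ((hasDerivAt_id (f x)).smul_const e).const_add (c x)
    have h2 := ((E.analytic _ (h x hx).1).differentiableAt.hasFDerivAt.comp_hasDerivAt
      (f x) hl2).sub_const (d x)
    rw [h1.unique h2]
    exact hd _ (h x hx).1
  · have ho : ∀ᶠ v in 𝓝 (x, f x), c v.1 + v.2 • e ∈ E.dom :=
      hin.continuousAt.preimage_mem_nhds (E.isOpen_dom.mem_nhds (h x hx).1)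
    have hv : ∀ᶠ v : V × 𝕜 in 𝓝 (x, f x), v.1 ∈ U :=
      continuousAt_fst.preimage_mem_nhds (hU.mem_nhds hx)
    filter_upwards [ho, hv] with v h1 h2 h3
    refine hu _ _ _ h1 (h _ h2).1 ?_
    rw [(h _ h2).2]
    rw [(h x hx).2] at h3
    simpa [sub_eq_zero] using h3

end Coordinates

namespace SolutionSpace

variable {𝕜 : Type*} [RCLike 𝕜] {E : Equation 𝕜} (Ω : SolutionSpace E)

/-- Analytic functions of the dynamical variables `u_{k,0}`, `u_{0,l}` with `|k|, |l| ≤ N`. -/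
def analyticFun (N : ℕ) : Subring (Ω.carrier → 𝕜) where
  carrier := {g | ∃ G : (cross N → 𝕜) → 𝕜,
    AnalyticOnNhd 𝕜 G (dynVars N '' Ω.carrier) ∧ ∀ u : Ω.carrier, g u = G (dynVars N u)}
  mul_mem' := by
    rintro _ _ ⟨G, hG, h⟩ ⟨G', hG', h'⟩
    exact ⟨G * G', hG.mul hG', fun u => by simp [h, h']⟩
  add_mem' := by
    rintro _ _ ⟨G, hG, h⟩ ⟨G', hG', h'⟩
    exact ⟨G + G', hG.add hG', fun u => by simp [h, h']⟩
  one_mem' := ⟨fun _ => 1, analyticOnNhd_const, fun _ => rfl⟩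
  zero_mem' := ⟨fun _ => 0, analyticOnNhd_const, fun _ => rfl⟩
  neg_mem' := by
    rintro _ ⟨G, hG, h⟩
    exact ⟨-G, hG.neg, fun u => by simp [h]⟩

lemma mem_analyticFun {N : ℕ} {g : Ω.carrier → 𝕜} :
    g ∈ Ω.analyticFun N ↔ ∃ G : (cross N → 𝕜) → 𝕜,
      AnalyticOnNhd 𝕜 G (dynVars N '' Ω.carrier) ∧ ∀ u : Ω.carrier, g u = G (dynVars N u) :=
  Iff.rfl

lemma cross_mono {N M : ℕ} (h : N ≤ M) : cross N ⊆ cross M := by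
  rintro ⟨a, b⟩ hs
  simp only [cross, Finset.mem_union, Finset.mem_product, Finset.mem_Icc,
    Finset.mem_singleton] at hs ⊢
  omega

lemma coord_cross_mem {N : ℕ} {s : ℤ × ℤ} (hs : s ∈ cross N) :
    (fun u : Ω.carrier => u.1 s) ∈ Ω.analyticFun N :=
  ⟨fun y => y ⟨s, hs⟩,
    fun _ _ => (ContinuousLinearMap.proj (R := 𝕜) (φ := fun _ : cross N => 𝕜)
      (⟨s, hs⟩ : cross N)).analyticAt _, fun _ => rfl⟩

/-- Composition of an analytic function with functions of the dynamical variables. -/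
lemma comp_mem {N : ℕ} {ι : Type*} [Fintype ι] {S : Set (ι → 𝕜)} {G : (ι → 𝕜) → 𝕜}
    (hG : AnalyticOnNhd 𝕜 G S) {c : ι → Ω.carrier → 𝕜} (hc : ∀ i, c i ∈ Ω.analyticFun N)
    (hS : ∀ u, (fun i => c i u) ∈ S) : (fun u => G (fun i => c i u)) ∈ Ω.analyticFun N := by
  choose C hC h using hc
  refine ⟨fun y => G (fun i => C i y), ?_, fun u => by simp [h]⟩
  rintro _ ⟨u, hu, rfl⟩
  have h1 : AnalyticAt 𝕜 (fun y i => C i y) (dynVars N u) :=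
    AnalyticAt.pi fun i => hC i _ ⟨u, hu, rfl⟩
  refine AnalyticAt.comp_of_eq (hG (fun i => c i ⟨u, hu⟩) (hS ⟨u, hu⟩)) h1 ?_
  funext i
  exact (h i ⟨u, hu⟩).symm

lemma analyticFun_mono {N M : ℕ} (h : N ≤ M) : Ω.analyticFun N ≤ Ω.analyticFun M := by
  rintro g ⟨G, hG, hg⟩
  have := Ω.comp_mem hG (c := fun s u => u.1 s)
    (fun s => Ω.coord_cross_mem (cross_mono h s.2)) (fun u => ⟨u.1, u.2, rfl⟩)
  convert this using 1
  funext u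
  exact hg u

/-- Composition of an analytic function with the values at the corners of a quad. -/
lemma comp_triple_mem {N : ℕ} {G : 𝕜 × 𝕜 × 𝕜 → 𝕜} (hG : AnalyticOnNhd 𝕜 G E.dom)
    {a b c : Ω.carrier → 𝕜} (ha : a ∈ Ω.analyticFun N) (hb : b ∈ Ω.analyticFun N)
    (hc : c ∈ Ω.analyticFun N) (hd : ∀ u, (a u, b u, c u) ∈ E.dom) :
    (fun u => G (a u, b u, c u)) ∈ Ω.analyticFun N := by
  obtain ⟨A, hA, ha⟩ := ha
  obtain ⟨B, hB, hb⟩ := hb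
  obtain ⟨C, hC, hc⟩ := hc
  refine ⟨fun y => G (A y, B y, C y), ?_, fun u => by simp [ha, hb, hc]⟩
  rintro _ ⟨u, hu, rfl⟩
  have hm : dynVars N u ∈ dynVars N '' Ω.carrier := ⟨u, hu, rfl⟩
  refine AnalyticAt.comp_of_eq (hG _ (hd ⟨u, hu⟩))
    ((hA _ hm).prod ((hB _ hm).prod (hC _ hm))) ?_
  simp [ha, hb, hc]

lemma solve_mem {N : ℕ} {e : 𝕜 × 𝕜 × 𝕜}
    (hd : ∀ p ∈ E.dom, fderiv 𝕜 E.F p e ≠ 0)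
    (hu : ∀ (p : 𝕜 × 𝕜 × 𝕜) (t s : 𝕜), p + t • e ∈ E.dom → p + s • e ∈ E.dom →
      E.F (p + t • e) = E.F (p + s • e) → t = s)
    {f d a b c : Ω.carrier → 𝕜} (hdm : d ∈ Ω.analyticFun N)
    (ha : a ∈ Ω.analyticFun N) (hb : b ∈ Ω.analyticFun N) (hc : c ∈ Ω.analyticFun N)
    (h : ∀ u, (a u, b u, c u) + f u • e ∈ E.dom ∧ E.F ((a u, b u, c u) + f u • e) = d u) :
    f ∈ Ω.analyticFun N := by
  obtain ⟨D, hD, hd'⟩ := hdm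
  obtain ⟨A, hA, ha⟩ := ha
  obtain ⟨B, hB, hb⟩ := hb
  obtain ⟨C, hC, hc⟩ := hc
  have hex : ∀ y : cross N → 𝕜, ∃ t : 𝕜, ∀ u : Ω.carrier, dynVars N u = y → f u = t := by
    intro y
    by_cases hy : ∃ u : Ω.carrier, dynVars N u = y
    · obtain ⟨u, rfl⟩ := hy
      refine ⟨f u, fun v hv => ?_⟩
      have h1 := h v
      have h2 := h u
      rw [ha, hb, hc, hd', hv] at h1
      rw [ha, hb, hc, hd'] at h2
      exact hu _ _ _ h1.1 h2.1 (h1.2.trans h2.2.symm)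
    · exact ⟨0, fun u hu => absurd ⟨u, hu⟩ hy⟩
  choose f' hf' using hex
  refine ⟨f', E.analyticOnNhd_solve hd hu (Ω.isOpen_dynVars N)
    (c := fun y => (A y, B y, C y)) (d := D) (fun y hy => (hA y hy).prod ((hB y hy).prod (hC y hy)))
    hD ?_, fun u => hf' _ u rfl⟩
  rintro _ ⟨u, hu, rfl⟩
  have h1 := h ⟨u, hu⟩
  rw [ha, hb, hc, hd', hf' _ ⟨u, hu⟩ rfl] at h1
  exact h1

/-- In a quad, each of the four values is an analytic function of the dynamical variables as soon
as the other three are. -/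
lemma coord_quad_mem {N : ℕ} (s : ℤ × ℤ) :
    let P := fun v : ℤ × ℤ => (fun u : Ω.carrier => u.1 (s + v)) ∈ Ω.analyticFun N
    (P (0, 0) → P (1, 0) → P (0, 1) → P (1, 1)) ∧ (P (0, 0) → P (1, 0) → P (1, 1) → P (0, 1)) ∧
    (P (0, 0) → P (0, 1) → P (1, 1) → P (1, 0)) ∧ (P (1, 0) → P (0, 1) → P (1, 1) → P (0, 0)) := by
  intro P
  have hz : s + ((0 : ℤ), (0 : ℤ)) = s := by ext <;> simp
  have hsol := fun u : Ω.carrier => Ω.isSolution u.1 u.2 s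
  have zero : (fun _ : Ω.carrier => (0 : 𝕜)) ∈ Ω.analyticFun N := (Ω.analyticFun N).zero_mem
  simp only [P, hz]
  refine ⟨fun h00 h10 h01 => ?_, fun h00 h10 h11 => ?_, fun h00 h01 h11 => ?_,
    fun h10 h01 h11 => ?_⟩
  · have := Ω.comp_triple_mem E.analytic h00 h10 h01 (fun u => (hsol u).1)
    convert this using 1
    funext u
    exact (hsol u).2
  · refine Ω.solve_mem (e := (0, 0, 1)) E.partialU01_ne_zero ?_ h11 h00 h10 zero fun u => ?_
    · rintro ⟨x, y, z⟩ t t' h1 h2 h3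
      simp only [Prod.smul_mk, smul_eq_mul, mul_zero, mul_one, Prod.mk_add_mk, add_zero]
        at h1 h2 h3
      simpa using E.unique_u01 _ _ _ _ h1 h2 h3
    · simpa [corner, eq_comm] using hsol u
  · refine Ω.solve_mem (e := (0, 1, 0)) E.partialU10_ne_zero ?_ h11 h00 zero h01 fun u => ?_
    · rintro ⟨x, y, z⟩ t t' h1 h2 h3
      simp only [Prod.smul_mk, smul_eq_mul, mul_zero, mul_one, Prod.mk_add_mk, add_zero]
        at h1 h2 h3
      simpa using E.unique_u10 _ _ _ _ h1 h2 h3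
    · simpa [corner, eq_comm] using hsol u
  · refine Ω.solve_mem (e := (1, 0, 0)) E.partialU_ne_zero ?_ h11 zero h10 h01 fun u => ?_
    · rintro ⟨x, y, z⟩ t t' h1 h2 h3
      simp only [Prod.smul_mk, smul_eq_mul, mul_zero, mul_one, Prod.mk_add_mk, add_zero]
        at h1 h2 h3
      simpa using E.unique_u _ _ _ _ h1 h2 h3
    · simpa [corner, eq_comm] using hsol u

/-- Every mixed shift `u_{p,q}`, `|p|, |q| ≤ N`, is an analytic function of the dynamical variables
`u_{k,0}`, `u_{0,l}` with `|k|, |l| ≤ N`. -/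
lemma coord_mem (N : ℕ) (p q : ℤ) (hp : |p| ≤ N) (hq : |q| ≤ N) :
    (fun u : Ω.carrier => u.1 (p, q)) ∈ Ω.analyticFun N := by
  have hx : ∀ p : ℤ, |p| ≤ N → (fun u : Ω.carrier => u.1 (p, 0)) ∈ Ω.analyticFun N := by
    intro p hp
    apply Ω.coord_cross_mem
    rw [abs_le] at hp
    simp [cross, hp]
  have hy : ∀ q : ℤ, |q| ≤ N → (fun u : Ω.carrier => u.1 (0, q)) ∈ Ω.analyticFun N := by
    intro q hq
    apply Ω.coord_cross_mem
    rw [abs_le] at hq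
    simp [cross, hq]
  have key : ∀ a : ℕ, a ≤ N → ∀ b : ℕ, b ≤ N →
      (fun u : Ω.carrier => u.1 ((a : ℤ), (b : ℤ))) ∈ Ω.analyticFun N ∧
      (fun u : Ω.carrier => u.1 ((a : ℤ), -(b : ℤ))) ∈ Ω.analyticFun N ∧
      (fun u : Ω.carrier => u.1 (-(a : ℤ), (b : ℤ))) ∈ Ω.analyticFun N ∧
      (fun u : Ω.carrier => u.1 (-(a : ℤ), -(b : ℤ))) ∈ Ω.analyticFun N := by
    intro a
    induction a with
    | zero =>
      intro _ b hb
      have h1 := hy b (by simpa using hb)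
      have h2 := hy (-b) (by simpa using hb)
      simpa using ⟨h1, h2, h1, h2⟩
    | succ a iha =>
      intro ha b
      induction b with
      | zero =>
        intro _
        have h1 := hx ((a + 1 : ℕ) : ℤ) (by rw [Nat.abs_cast]; exact_mod_cast ha)
        have h2 := hx (-((a + 1 : ℕ) : ℤ)) (by rw [abs_neg, Nat.abs_cast]; exact_mod_cast ha)
        simp only [Nat.cast_zero, neg_zero]
        exact ⟨h1, h1, h2, h2⟩
      | succ b ihb =>
        intro hb
        have i1 := iha (by omega) b (by omega)
        have i2 := iha (by omega) (b + 1) hb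
        have i3 := ihb (by omega)
        refine ⟨?_, ?_, ?_, ?_⟩
        · have := (Ω.coord_quad_mem (N := N) ((a : ℤ), (b : ℤ))).1
          simp only [Prod.mk_add_mk, add_zero] at this
          push_cast at *
          exact this i1.1 i3.1 i2.1
        · have := (Ω.coord_quad_mem (N := N) ((a : ℤ), -((b : ℤ) + 1))).2.2.1
          simp only [Prod.mk_add_mk, add_zero] at this
          have e : -((b : ℤ) + 1) + 1 = -b := by ring
          rw [e] at this
          push_cast at *
          exact this i2.2.1 i1.2.1 i3.2.1
        · have := (Ω.coord_quad_mem (N := N) (-((a : ℤ) + 1), (b : ℤ))).2.1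
          simp only [Prod.mk_add_mk, add_zero] at this
          have e : -((a : ℤ) + 1) + 1 = -a := by ring
          rw [e] at this
          push_cast at *
          exact this i3.2.2.1 i1.2.2.1 i2.2.2.1
        · have := (Ω.coord_quad_mem (N := N) (-((a : ℤ) + 1), -((b : ℤ) + 1))).2.2.2
          simp only [Prod.mk_add_mk, add_zero] at this
          have e : -((a : ℤ) + 1) + 1 = -a := by ring
          have e' : -((b : ℤ) + 1) + 1 = -b := by ring
          rw [e, e'] at this
          push_cast at *
          exact this i2.2.2.2 i3.2.2.2 i1.2.2.2
  have hk := key p.natAbs (by zify; simpa using hp) q.natAbs (by zify; simpa using hq)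
  rcases Int.natAbs_eq p with h | h <;> rcases Int.natAbs_eq q with h' | h' <;>
    rw [h, h']
  · exact hk.1
  · exact hk.2.1
  · exact hk.2.2.1
  · exact hk.2.2.2

/-- The ring of the analytic functions `g[u]` of finitely many dynamical variables. -/
def analyticRing : Subring (Ω.carrier → 𝕜) where
  carrier := {g | ∃ N, g ∈ Ω.analyticFun N}
  mul_mem' := by
    rintro _ _ ⟨N, h⟩ ⟨M, h'⟩
    exact ⟨max N M, mul_mem (Ω.analyticFun_mono (le_max_left _ _) h)
      (Ω.analyticFun_mono (le_max_right _ _) h')⟩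
  add_mem' := by
    rintro _ _ ⟨N, h⟩ ⟨M, h'⟩
    exact ⟨max N M, add_mem (Ω.analyticFun_mono (le_max_left _ _) h)
      (Ω.analyticFun_mono (le_max_right _ _) h')⟩
  one_mem' := ⟨0, one_mem _⟩
  zero_mem' := ⟨0, zero_mem _⟩
  neg_mem' := by
    rintro _ ⟨N, h⟩
    exact ⟨N, neg_mem h⟩

lemma eq_zero_or_eq_zero_of_mul {N : ℕ} {f g : Ω.carrier → 𝕜} (hf : f ∈ Ω.analyticFun N)
    (hg : g ∈ Ω.analyticFun N) (h : f * g = 0) : f = 0 ∨ g = 0 := by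
  obtain ⟨A, hA, hf⟩ := hf
  obtain ⟨B, hB, hg⟩ := hg
  by_contra! hne
  obtain ⟨u, hu⟩ := Function.ne_iff.1 hne.1
  apply hne.2
  have hz : ∀ y ∈ dynVars N '' Ω.carrier, A y * B y = 0 := by
    rintro _ ⟨v, hv, rfl⟩
    have := congrFun h ⟨v, hv⟩
    simpa [hf, hg] using this
  have hum : dynVars N u.1 ∈ dynVars N '' Ω.carrier := ⟨u.1, u.2, rfl⟩
  have hB0 : B =ᶠ[𝓝 (dynVars N u.1)] 0 := by
    have h1 : ∀ᶠ y in 𝓝 (dynVars N u.1), A y ≠ 0 :=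
      (hA _ hum).continuousAt.eventually_ne (by simpa [hf] using hu)
    filter_upwards [h1, (Ω.isOpen_dynVars N).mem_nhds hum] with y h2 h3
    exact (mul_eq_zero.1 (hz y h3)).resolve_left h2
  have := hB.eqOn_zero_of_preconnected_of_eventuallyEq_zero
    (Ω.isConnected_dynVars N).isPreconnected hum hB0
  funext v
  rw [hg]
  exact this ⟨v.1, v.2, rfl⟩

instance : IsDomain Ω.analyticRing := by
  have : Nonempty Ω.carrier := by
    obtain ⟨_, u, hu, _⟩ := (Ω.isConnected_dynVars 0).nonempty
    exact ⟨u, hu⟩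
  have : NoZeroDivisors Ω.analyticRing := by
    refine ⟨?_⟩
    rintro ⟨f, N, hf⟩ ⟨g, M, hg⟩ h
    have h' : f * g = 0 := congrArg Subtype.val h
    rcases Ω.eq_zero_or_eq_zero_of_mul (Ω.analyticFun_mono (le_max_left N M) hf)
      (Ω.analyticFun_mono (le_max_right N M) hg) h' with h | h
    · exact Or.inl (Subtype.ext h)
    · exact Or.inr (Subtype.ext h)
  exact NoZeroDivisors.to_isDomain _

/-- The field of functions `g[u]` of finitely many dynamical variables: quotients of analytic
functions of the dynamical variables. -/
def FunField : Type _ := FractionRing Ω.analyticRing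

instance : Field Ω.FunField := inferInstanceAs (Field (FractionRing Ω.analyticRing))

instance : Algebra Ω.analyticRing Ω.FunField :=
  inferInstanceAs (Algebra Ω.analyticRing (FractionRing Ω.analyticRing))

instance : IsFractionRing Ω.analyticRing Ω.FunField :=
  inferInstanceAs (IsFractionRing Ω.analyticRing (FractionRing Ω.analyticRing))

/-- The functions in the field which depend on the dynamical variables `u_{k,0}`, `u_{0,l}` with
`|k|, |l| ≤ N` only. -/
def DependsOn (N : ℕ) (g : Ω.FunField) : Prop :=
  ∃ a b : Ω.analyticRing, a.1 ∈ Ω.analyticFun N ∧ b.1 ∈ Ω.analyticFun N ∧ b ≠ 0 ∧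
    g = algebraMap _ Ω.FunField a / algebraMap _ Ω.FunField b

/-- The shift by `v`, as a map of the solution space. -/
def translateSol (v : ℤ × ℤ) (u : Ω.carrier) : Ω.carrier :=
  ⟨translate v u.1, Ω.translate_mem v u.1 u.2⟩

lemma comp_translateSol_mem {N : ℕ} (v : ℤ × ℤ) {g : Ω.carrier → 𝕜} (hg : g ∈ Ω.analyticFun N) :
    g ∘ Ω.translateSol v ∈ Ω.analyticFun (N + v.1.natAbs + v.2.natAbs) := by
  obtain ⟨G, hG, hg⟩ := hg
  have := Ω.comp_mem (N := N + v.1.natAbs + v.2.natAbs) hG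
    (c := fun s u => u.1 (s.1 + v)) ?_ (fun u => ?_)
  · convert this using 1
    funext u
    exact hg _
  · rintro ⟨⟨a, b⟩, hs⟩
    simp only [cross, Finset.mem_union, Finset.mem_product, Finset.mem_Icc,
      Finset.mem_singleton] at hs
    obtain ⟨p, q⟩ := v
    have h1 := le_abs_self p
    have h2 := neg_abs_le p
    have h3 := le_abs_self q
    have h4 := neg_abs_le q
    refine Ω.coord_mem _ (a + p) (b + q) ?_ ?_ <;> · push_cast; rw [abs_le]; omega
  · exact ⟨translate v u.1, Ω.translate_mem v u.1 u.2, rfl⟩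

/-- The shift operator `T_i^p T_j^q`, `v = (p, q)`, on analytic functions: every `u_{m,n}` is
replaced by `u_{m+p,n+q}`. -/
def shiftAnalytic (v : ℤ × ℤ) : Ω.analyticRing ≃+* Ω.analyticRing where
  toFun g := ⟨g.1 ∘ Ω.translateSol v, by
    obtain ⟨N, h⟩ := g.2
    exact ⟨_, Ω.comp_translateSol_mem v h⟩⟩
  invFun g := ⟨g.1 ∘ Ω.translateSol (-v), by
    obtain ⟨N, h⟩ := g.2
    exact ⟨_, Ω.comp_translateSol_mem (-v) h⟩⟩
  left_inv g := by
    apply Subtype.ext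
    funext u
    refine congrArg g.1 (Subtype.ext (funext fun s => ?_))
    simp [translateSol, translate]
  right_inv g := by
    apply Subtype.ext
    funext u
    refine congrArg g.1 (Subtype.ext (funext fun s => ?_))
    simp [translateSol, translate]
  map_mul' _ _ := rfl
  map_add' _ _ := rfl

/-- The shift operator `T_i^p T_j^q`, `v = (p, q)`, on the functions `g[u]`. -/
def shift (v : ℤ × ℤ) : Ω.FunField ≃+* Ω.FunField :=
  IsFractionRing.ringEquivOfRingEquiv (Ω.shiftAnalytic v)

/-- An analytic function on the domain of the right-hand side, evaluated at `(u, u₁₀, u₀₁)`. -/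
def ofTriple (G : 𝕜 × 𝕜 × 𝕜 → 𝕜) (hG : AnalyticOnNhd 𝕜 G E.dom) : Ω.FunField :=
  algebraMap Ω.analyticRing Ω.FunField ⟨fun u => G (corner u.1 0), 1,
    Ω.comp_triple_mem hG (Ω.coord_mem 1 0 0 (by simp) (by simp))
      (Ω.coord_mem 1 1 0 (by simp) (by simp)) (Ω.coord_mem 1 0 1 (by simp) (by simp))
      (fun u => (Ω.isSolution u.1 u.2 0).1)⟩

/-- The partial derivative `F_u` as a function of the dynamical variables. -/
def Fu : Ω.FunField :=
  Ω.ofTriple (partialU E.F) fun p hp =>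
    ((ContinuousLinearMap.apply 𝕜 𝕜 ((1, 0, 0) : 𝕜 × 𝕜 × 𝕜)).analyticAt _).comp
      (E.analytic.fderiv p hp)

/-- The partial derivative `F_{u₁₀}` as a function of the dynamical variables. -/
def Fu10 : Ω.FunField :=
  Ω.ofTriple (partialU10 E.F) fun p hp =>
    ((ContinuousLinearMap.apply 𝕜 𝕜 ((0, 1, 0) : 𝕜 × 𝕜 × 𝕜)).analyticAt _).comp
      (E.analytic.fderiv p hp)

/-- The partial derivative `F_{u₀₁}` as a function of the dynamical variables. -/
def Fu01 : Ω.FunField :=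
  Ω.ofTriple (partialU01 E.F) fun p hp =>
    ((ContinuousLinearMap.apply 𝕜 𝕜 ((0, 0, 1) : 𝕜 × 𝕜 × 𝕜)).analyticAt _).comp
      (E.analytic.fderiv p hp)

/-- Functions `f[i,j,u]` which may depend on `i`, `j` and on dynamical variables. The dynamical
variables are required to form a finite set which is the same for all `i`, `j` in
`IsFun` below. -/
abbrev LatticeFun : Type _ := ℤ × ℤ → Ω.FunField

/-- `f[i,j,u]` depends on a finite set of dynamical variables which is the same for all `i`, `j`. -/
def IsFun (f : Ω.LatticeFun) : Prop := ∃ N, ∀ s, Ω.DependsOn N (f s)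

/-- Operators acting on functions `f[i,j,u]`; the product is the composition. -/
abbrev Operator : Type _ := AddMonoid.End Ω.LatticeFun

/-- Multiplication by a function `g[u]`, as an operator. -/
def mulOp (g : Ω.FunField) : Ω.Operator := AddMonoidHom.mulLeft (fun _ => g)

/-- The shift operator `T_i^p T_j^q`, `v = (p, q)`, on functions `f[i,j,u]`:
it sends `f[i,j,u]` to `f[i+p,j+q,T_i^p T_j^q u]`. -/
def T (v : ℤ × ℤ) : Ω.Operator where
  toFun f := fun s => Ω.shift v (f (s + v))
  map_zero' := by ext; simp
  map_add' _ _ := by ext; simp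

/-- The forward shift `T_i` in `i`. -/
abbrev Ti : Ω.Operator := Ω.T (1, 0)

/-- The forward shift `T_j` in `j`. -/
abbrev Tj : Ω.Operator := Ω.T (0, 1)

/-- The linearization operator `L = T_i T_j - F_{u₁₀} T_i - F_{u₀₁} T_j - F_u`. -/
def L : Ω.Operator :=
  Ω.Ti * Ω.Tj - Ω.mulOp Ω.Fu10 * Ω.Ti - Ω.mulOp Ω.Fu01 * Ω.Tj - Ω.mulOp Ω.Fu

/-- The operator `∑_{k=0}^{m} c_k[u] S^k`. -/
def polyOp (S : Ω.Operator) (m : ℕ) (c : ℕ → Ω.FunField) : Ω.Operator :=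
  ∑ k ∈ Finset.range (m + 1), Ω.mulOp (c k) * S ^ k

/-- Symmetries `f[i,j,u]` of the equation. -/
def IsSymmetry (f : Ω.LatticeFun) : Prop := Ω.IsFun f ∧ Ω.L f = 0

/-- `R = ∑_{k=0}^{r} λ_k[u] S^k` is a symmetry driver, where `S` is one of the shifts `T_i`, `T_j`
and `S'` is the other one: `λ_r ≠ 0` and `R(ξ)` is a symmetry for any `ξ[i,j,u] ∈ ker (S' - 1)`. -/
def IsSymmetryDriver (S S' : Ω.Operator) (r : ℕ) (lam : ℕ → Ω.FunField) : Prop :=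
  lam r ≠ 0 ∧ ∀ ξ : Ω.LatticeFun, Ω.IsFun ξ → (S' - 1) ξ = 0 → Ω.IsSymmetry (Ω.polyOp S r lam ξ)

/-- `I = ∑_{k=0}^{m} μ_k[u] S^k` is a formal integral, where `S` is one of the shifts `T_i`, `T_j`
and `S'` is the other one: `m > 0`, `μ_m ≠ 0` and `(S' - 1) I = ∑_{k=0}^{m-1} ν_k[u] S^k L` for some
functions `ν_k[u]`. -/
def IsFormalIntegral (S S' : Ω.Operator) (m : ℕ) (μ : ℕ → Ω.FunField) : Prop :=
  0 < m ∧ μ m ≠ 0 ∧ ∃ ν : ℕ → Ω.FunField,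
    (S' - 1) * Ω.polyOp S m μ = Ω.polyOp S (m - 1) ν * Ω.L

/-- The equation admits an `i`-symmetry driver. -/
def HasISymmetryDriver : Prop := ∃ r lam, Ω.IsSymmetryDriver Ω.Ti Ω.Tj r lam

/-- The equation admits a `j`-symmetry driver. -/
def HasJSymmetryDriver : Prop := ∃ r lam, Ω.IsSymmetryDriver Ω.Tj Ω.Ti r lam

/-- The equation admits a formal `i`-integral. -/
def HasFormalIIntegral : Prop := ∃ m μ, Ω.IsFormalIntegral Ω.Ti Ω.Tj m μ

/-- The equation admits a formal `j`-integral. -/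
def HasFormalJIntegral : Prop := ∃ n β, Ω.IsFormalIntegral Ω.Tj Ω.Ti n β

end SolutionSpace

end QuadGraph

end

/-! Comparing coefficients turns both notions into relations for a finitely supported sequence over
a field with an action of ℤ²: `IntegralCoeffs`, where the coefficients of the integral itself are
eliminated and only those of the left factor of L remain, and `DriverCoeffs`. Passing to the formal
adjoint of L exchanges the two (`driverCoeffs_iff_adjoint`), at the price of inverting the action.
So it is enough to obtain drivers from integrals; the converse is the same statement for the adjoint
equation.

If r is a driver, the array s(k, j) = T_i^{-j} T_j^k (r_j) solves a linear equation, has finite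
width, and each of its rows is T_j of the previous one. The proof looks for such an array. Let N be
the top index of the left factor in the j-integral. On N + 1 rows a count of unknowns and equations
gives a nonzero solution of finite width (`exists_isStripSolution`). At minimal width the solutions
form a line, since the last column is governed by its entry in row 0
(`exists_minimal_isStripSolution`). The j-integral supplies one more row of the same width; dropping
row 0 and applying T_j^{-1} gives another minimal solution (`IsStripSolution.exists_next`), hence a
multiple of the first. Row 0 therefore satisfies the driver relation up to a scalar factor, and the
leading coefficient of the i-integral (`IntegralCoeffs.exists_gauge`) allows a rescaling that
removes this factor. -/

namespace QuadGraph

/-! ### Coefficient relations over a field with an action of ℤ². -/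

section Coefficients

variable {K : Type*} [Field K]

/-- The family `φ p q` of automorphisms of a field is an action of the group `ℤ × ℤ`. -/
structure IsLatticeAction (φ : ℤ → ℤ → K ≃+* K) : Prop where
  zero : ∀ x, φ 0 0 x = x
  add : ∀ p q p' q' x, φ p q (φ p' q' x) = φ (p + p') (q + q') x

/-- The relations between the coefficients of an operator `N = ∑ n_k T_i^k` which express that
`(T_j - 1) I = N L` for some operator `I` in powers of `T_i`. Here `φ p q` stands for
`T_i^p T_j^q`, and `L = T_i T_j - a T_i - b T_j - c`. -/
def IntegralCoeffs (φ : ℤ → ℤ → K ≃+* K) (a b c : K) : Prop :=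
  ∃ n : ℤ → K, n.support.Finite ∧ n ≠ 0 ∧ ∀ k,
    n (k - 1) - n k * φ k 0 b = φ 0 1 (n (k - 1)) * φ (k - 1) 1 a + φ 0 1 (n k) * φ k 1 c

/-- The relations between the coefficients of an operator `R = ∑ r_k T_i^k` which express that
`L R` vanishes on the kernel of `T_j - 1`. -/
def DriverCoeffs (φ : ℤ → ℤ → K ≃+* K) (a b c : K) : Prop :=
  ∃ r : ℤ → K, r.support.Finite ∧ r ≠ 0 ∧ ∀ k,
    φ 1 1 (r (k - 1)) - b * φ 0 1 (r k) = a * φ 1 0 (r (k - 1)) + c * r k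

/-- Solutions of the equation with the coefficients `a`, `b`, `c`, skewed by the action, which are
supported in a rectangle with `N + 1` rows of length `w`. -/
def IsStripSolution (φ : ℤ → ℤ → K ≃+* K) (a b c : K) (N w : ℕ) (s : ℤ → ℤ → K) : Prop :=
  (∀ k j : ℤ, ¬(0 ≤ k ∧ k ≤ N ∧ 0 ≤ j ∧ j < w) → s k j = 0) ∧
    ∀ k j : ℤ, 0 ≤ k → k < N → s (k + 1) (j - 1) - φ (-j) k b * s (k + 1) j =
      φ (-j) k a * s k (j - 1) + φ (-j) k c * s k j

lemma sum_range_shift {M : ℕ} {u X : ℤ → K} (h : u (-1) = 0) :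
    ∑ l ∈ Finset.range (M + 1), u ((l : ℤ) - 1) * X l =
      ∑ l ∈ Finset.range M, u l * X ((l : ℤ) + 1) := by
  rw [Finset.sum_range_succ']
  simp [h]

lemma sum_range_drop {M : ℕ} {u X : ℤ → K} (h : u M = 0) :
    ∑ l ∈ Finset.range (M + 1), u l * X l = ∑ l ∈ Finset.range M, u l * X l := by
  rw [Finset.sum_range_succ]
  simp [h]

lemma IsLatticeAction.swap {φ : ℤ → ℤ → K ≃+* K} (h : IsLatticeAction φ) :
    IsLatticeAction fun p q => φ q p :=
  ⟨h.zero, fun _ _ _ _ _ => h.add _ _ _ _ _⟩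

lemma IsLatticeAction.neg {φ : ℤ → ℤ → K ≃+* K} (h : IsLatticeAction φ) :
    IsLatticeAction fun p q => φ (-p) (-q) :=
  ⟨by simpa using h.zero, fun _ _ _ _ _ => by
    rw [h.add, neg_add, neg_add]⟩

/-- An integral for the adjoint equation is a driver. -/
lemma driverCoeffs_iff_adjoint {φ : ℤ → ℤ → K ≃+* K} (h : IsLatticeAction φ) (a b c : K) :
    DriverCoeffs φ a b c ↔
      IntegralCoeffs (fun p q => φ (-p) (-q)) (φ (-1) 0 a) (φ 0 (-1) b) c := by
  constructor
  · rintro ⟨r, hf, hr, he⟩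
    -- The adjoint of r_k T_i^k is T_i^{-k} r_k, whose coefficient on the left is T_i^{-k}(r_k).
    -- Applying T_i^{-k} T_j^{-1} to the driver relation gives the integral relation.
    refine ⟨fun k => φ (-k) 0 (r k), hf.subset fun k hk => ?_, ?_, fun k => ?_⟩
    · simpa using hk
    · obtain ⟨k, hk⟩ := Function.ne_iff.1 hr
      exact Function.ne_iff.2 ⟨k, by simpa using hk⟩
    · have := congrArg (φ (-k) (-1)) (he k)
      simp only [map_sub, map_add, map_mul, h.add] at this ⊢
      convert this using 2 <;> ring_nf
  · rintro ⟨n, hf, hn, he⟩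
    refine ⟨fun k => φ k 0 (n k), hf.subset fun k hk => ?_, ?_, fun k => ?_⟩
    · simpa using hk
    · obtain ⟨k, hk⟩ := Function.ne_iff.1 hn
      exact Function.ne_iff.2 ⟨k, by simpa using hk⟩
    · have := congrArg (φ k 1) (he k)
      simp only [map_sub, map_add, map_mul, h.add] at this ⊢
      convert this using 2 <;> ring_nf <;> simp [h.zero, mul_comm]

lemma exists_top {n : ℤ → K} (hf : n.support.Finite) (hn : n ≠ 0) :
    ∃ p, n p ≠ 0 ∧ ∀ k, p < k → n k = 0 := by
  obtain ⟨k, hk⟩ := Function.ne_iff.1 hn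
  obtain ⟨p, hp, hm⟩ := hf.exists_maximal ⟨k, hk⟩
  refine ⟨p, hp, fun k hk => ?_⟩
  by_contra h
  exact absurd (hm h hk.le) (not_le.2 hk)

lemma exists_normalized {n : ℤ → K} (hf : n.support.Finite) (hn : n ≠ 0) :
    ∃ (p : ℤ) (N : ℕ), n (N + p) ≠ 0 ∧ ∀ k : ℤ, ¬(0 ≤ k ∧ k ≤ N) → n (k + p) = 0 := by
  obtain ⟨q, hq, hq'⟩ := exists_top hf hn
  -- The lowest index is the top index of the reflected sequence.
  obtain ⟨p, hp, hp'⟩ := exists_top (n := fun k => n (-k))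
    (hf.preimage (f := Neg.neg) neg_injective.injOn) (by
      obtain ⟨k, hk⟩ := Function.ne_iff.1 hn
      exact Function.ne_iff.2 ⟨-k, by simpa using hk⟩)
  have hpq : -p ≤ q := by
    by_contra! h
    exact hp (hq' _ h)
  refine ⟨-p, (q + p).toNat, ?_, fun k hk => ?_⟩
  · rw [Int.toNat_of_nonneg (by omega)]
    simpa using hq
  · rw [Int.toNat_of_nonneg (by omega)] at hk
    by_cases h : 0 ≤ k
    · exact hq' _ (by omega)
    · have := hp' (-k + p) (by omega)
      rwa [neg_add_rev, neg_neg, add_comm] at this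

/-- The coefficients in `IntegralCoeffs` can be chosen with the lowest index at least zero. -/
lemma IntegralCoeffs.normalize {φ : ℤ → ℤ → K ≃+* K} (h : IsLatticeAction φ) {a b c : K}
    (hI : IntegralCoeffs φ a b c) : ∃ (n : ℤ → K) (N : ℕ), n N ≠ 0 ∧
      (∀ k : ℤ, ¬(0 ≤ k ∧ k ≤ N) → n k = 0) ∧ ∀ k, n (k - 1) - n k * φ k 0 b =
        φ 0 1 (n (k - 1)) * φ (k - 1) 1 a + φ 0 1 (n k) * φ k 1 c := by
  obtain ⟨n, hf, hn, he⟩ := hI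
  obtain ⟨p, N, hN, h0⟩ := exists_normalized hf hn
  refine ⟨fun k => φ (-p) 0 (n (k + p)), N, by simpa using hN, fun k hk => ?_, fun k => ?_⟩
  · simp [h0 k hk]
  · have := congrArg (φ (-p) 0) (he (k + p))
    simp only [map_sub, map_add, map_mul, h.add] at this ⊢
    convert this using 2 <;> ring_nf

/-- The coefficients in `DriverCoeffs` can be chosen with the lowest index at least zero. -/
lemma DriverCoeffs.normalize {φ : ℤ → ℤ → K ≃+* K} {a b c : K}
    (hD : DriverCoeffs φ a b c) : ∃ (r : ℤ → K) (N : ℕ), r N ≠ 0 ∧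
      (∀ k : ℤ, ¬(0 ≤ k ∧ k ≤ N) → r k = 0) ∧ ∀ k,
        φ 1 1 (r (k - 1)) - b * φ 0 1 (r k) = a * φ 1 0 (r (k - 1)) + c * r k := by
  obtain ⟨r, hf, hr, he⟩ := hD
  obtain ⟨p, N, hN, h0⟩ := exists_normalized hf hr
  refine ⟨fun k => r (k + p), N, hN, h0, fun k => ?_⟩
  have := he (k + p)
  rwa [add_sub_right_comm] at this

/-- The leading coefficient of a formal integral. -/
lemma IntegralCoeffs.exists_gauge {φ : ℤ → ℤ → K ≃+* K} (h : IsLatticeAction φ) {a b c : K}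
    (hI : IntegralCoeffs φ a b c) : ∃ g, g ≠ 0 ∧ g = φ 0 1 g * a := by
  obtain ⟨n, N, hN, h0, he⟩ := hI.normalize h
  -- At index N + 1 only n_N survives: n_N = T_j(n_N) · T_i^N T_j(a). The shift in the witness
  -- brings the last factor back to a.
  refine ⟨φ (-N) (-1) (n N), by simpa using hN, ?_⟩
  have h1 := he (N + 1)
  rw [h0 (N + 1) (by omega)] at h1
  have := congrArg (φ (-N) (-1)) h1
  simp only [map_mul, map_zero, h.add, zero_mul, sub_zero, add_zero, add_sub_cancel_right] at this ⊢
  rw [this]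
  simp [h.zero]

/-! ### Solutions of finite width on a strip. -/

section Strip

variable {φ : ℤ → ℤ → K ≃+* K} {a b c : K} {N : ℕ}

/-- A function on a finite rectangle, extended by zero. -/
def extendRect (n m : ℕ) : (Fin n × Fin m → K) →ₗ[K] ℤ → ℤ → K where
  toFun v k j := if h : (0 ≤ k ∧ k < n) ∧ 0 ≤ j ∧ j < m then
    v (⟨k.toNat, by omega⟩, ⟨j.toNat, by omega⟩) else 0
  map_add' v v' := by
    funext k j
    by_cases h : (0 ≤ k ∧ k < n) ∧ 0 ≤ j ∧ j < m <;> simp [h]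
  map_smul' x v := by
    funext k j
    by_cases h : (0 ≤ k ∧ k < n) ∧ 0 ≤ j ∧ j < m <;> simp [h]

/-- There are (N + 1)² unknowns. Each of the N pairs of adjacent rows gives an equation for j = 0,
…, N + 1 only, so N(N + 2) equations in all, one fewer than the unknowns. -/
lemma exists_isStripSolution (φ : ℤ → ℤ → K ≃+* K) (a b c : K) (N : ℕ) :
    ∃ s, s ≠ 0 ∧ IsStripSolution φ a b c N (N + 1) s := by
  let f : (Fin (N + 1) × Fin (N + 1) → K) →ₗ[K] (Fin N × Fin (N + 2) → K) :=
    { toFun := fun v q =>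
        extendRect (N + 1) (N + 1) v (q.1 + 1) ((q.2 : ℤ) - 1)
          - φ (-q.2) q.1 b * extendRect (N + 1) (N + 1) v (q.1 + 1) q.2
          - φ (-q.2) q.1 a * extendRect (N + 1) (N + 1) v q.1 ((q.2 : ℤ) - 1)
          - φ (-q.2) q.1 c * extendRect (N + 1) (N + 1) v q.1 q.2
      map_add' := fun v v' => by
        funext q
        simp only [map_add, Pi.add_apply]
        ring
      map_smul' := fun x v => by
        funext q
        simp only [map_smul, Pi.smul_apply, smul_eq_mul, RingHom.id_apply]
        ring }
  have hk : LinearMap.ker f ≠ ⊥ := by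
    apply LinearMap.ker_ne_bot_of_finrank_lt
    simp only [Module.finrank_fintype_fun_eq_card, Fintype.card_prod, Fintype.card_fin]
    nlinarith
  obtain ⟨v, hv, hv0⟩ := (Submodule.ne_bot_iff _).1 hk
  have hz : ∀ k j : ℤ, ¬(0 ≤ k ∧ k ≤ N ∧ 0 ≤ j ∧ j < (N + 1 : ℕ)) →
      extendRect (N + 1) (N + 1) v k j = 0 := by
    intro k j h
    exact dif_neg (by push_cast at *; omega)
  refine ⟨extendRect (N + 1) (N + 1) v, fun h => hv0 ?_, hz, fun k j hk0 hkN => ?_⟩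
  · funext ⟨p, q⟩
    have := congrFun (congrFun h p) q
    simpa [extendRect, p.is_le, q.is_le] using this
  · by_cases hj : 0 ≤ j ∧ j < N + 2
    · have h1 := congrFun (LinearMap.mem_ker.1 hv)
        (⟨k.toNat, by omega⟩, ⟨j.toNat, by omega⟩)
      simp only [f, LinearMap.coe_mk, AddHom.coe_mk, Int.toNat_of_nonneg hk0,
        Int.toNat_of_nonneg hj.1, Pi.zero_apply] at h1
      linear_combination h1
    · rw [hz (k + 1) (j - 1) (by push_cast; omega), hz (k + 1) j (by push_cast; omega),
        hz k (j - 1) (by push_cast; omega), hz k j (by push_cast; omega)]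
      simp

/-- The equation one step to the right of the last column reads s(k+1, d) = T_i^{-(d+1)} T_j^k(a) ·
s(k, d), so a zero in row 0 propagates along the whole column. -/
lemma IsStripSolution.narrow {d : ℕ} {s : ℤ → ℤ → K}
    (hs : IsStripSolution φ a b c N (d + 1) s) (h0 : s 0 d = 0) :
    IsStripSolution φ a b c N d s := by
  have key : ∀ k : ℕ, k ≤ N → s k d = 0 := by
    intro k
    induction k with
    | zero => exact fun _ => h0
    | succ k ih =>
      intro hk
      have h1 := hs.2 k (d + 1) (by omega) (by omega)
      rw [hs.1 (k + 1) (d + 1) (by push_cast; omega), hs.1 k (d + 1) (by push_cast; omega),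
        add_sub_cancel_right, ih (by omega)] at h1
      simpa using h1
  refine ⟨fun k j h => ?_, hs.2⟩
  by_cases h1 : 0 ≤ k ∧ k ≤ N ∧ j = d
  · obtain ⟨h2, h3, rfl⟩ := h1
    lift k to ℕ using h2
    exact key k (by omega)
  · exact hs.1 k j (by push_cast; omega)

lemma IsStripSolution.sub_smul {w : ℕ} {s t : ℤ → ℤ → K} (hs : IsStripSolution φ a b c N w s)
    (ht : IsStripSolution φ a b c N w t) (x : K) :
    IsStripSolution φ a b c N w fun k j => t k j - x * s k j := by
  refine ⟨fun k j h => by simp [hs.1 k j h, ht.1 k j h], fun k j h h' => ?_⟩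
  linear_combination ht.2 k j h h' - x * hs.2 k j h h'

/-- A formal integral in the direction of the columns of the strip allows one to move the strip by
one row. -/
lemma IsStripSolution.exists_next (h : IsLatticeAction φ) (hb : b ≠ 0) {ν : ℤ → K}
    (hN : ν N ≠ 0) (h0 : ∀ k : ℤ, ¬(0 ≤ k ∧ k ≤ N) → ν k = 0)
    (he : ∀ k, ν (k - 1) - ν k * φ 0 k a =
      φ 1 0 (ν (k - 1)) * φ 1 (k - 1) b + φ 1 0 (ν k) * φ 1 k c)
    {w : ℕ} {s : ℤ → ℤ → K} (hs : IsStripSolution φ a b c N w s) :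
    ∃ t, IsStripSolution φ a b c N w t ∧ ∀ j,
      φ 0 1 (t 0 (j - 1)) - φ (-j) 0 b * φ 0 1 (t 0 j) =
        φ (-j) 0 a * s 0 (j - 1) + φ (-j) 0 c * s 0 j := by
  set J : ℤ → K := fun l => ν (l - 1) * φ 0 (l - 1) b + ν l * φ 0 l c with hJ
  have hJ' : ∀ l, φ 1 0 (J l) = ν (l - 1) - ν l * φ 0 l a := by
    intro l
    rw [he]
    simp [hJ, h.add]
  have hJN : J (N + 1) ≠ 0 := by
    simp [hJ, h0 (N + 1) (by omega), hN, hb]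
  -- Row N + 1 is chosen so that the integral ∑ J_l S(l, j), suitably shifted, vanishes at every j.
  -- This is possible because J_{N+1} = ν_N T_j^N(b) is nonzero, and it keeps the width.
  let S : ℤ → ℤ → K := fun k j => if k = N + 1 then
    -(φ (-j) 0 (J (N + 1)))⁻¹ * ∑ l ∈ Finset.range (N + 1), φ (-j) 0 (J l) * s l j else s k j
  have hS : ∀ k j : ℤ, k ≠ N + 1 → S k j = s k j := fun k j hk => if_neg hk
  have hsum : ∀ j, ∑ l ∈ Finset.range (N + 2), φ (-j) 0 (J l) * S l j = 0 := by
    intro j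
    rw [Finset.sum_range_succ]
    have h1 : ∀ l ∈ Finset.range (N + 1), φ (-j) 0 (J l) * S l j = φ (-j) 0 (J l) * s l j := by
      intro l hl
      rw [hS l j (by have := Finset.mem_range.1 hl; omega)]
    rw [Finset.sum_congr rfl h1]
    have h2 : φ (-j) 0 (J (N + 1)) ≠ 0 := by simpa using hJN
    simp only [S]
    push_cast
    rw [if_pos rfl]
    field_simp
    ring
  have hrow : ∀ k j : ℤ, 0 ≤ k → k ≤ N → S (k + 1) (j - 1) - φ (-j) k b * S (k + 1) j =
      φ (-j) k a * S k (j - 1) + φ (-j) k c * S k j := by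
    intro k j hk hkN
    rcases hkN.lt_or_eq with hkN | rfl
    · rw [hS _ _ (by omega), hS _ _ (by omega), hS _ _ (by omega), hS _ _ (by omega)]
      exact hs.2 k j hk hkN
    · let u : ℤ → K := fun l => φ (-j) 0 (ν l)
      have hu1 : u (-1) = 0 := by simp [u, h0 (-1) (by omega)]
      have huN : u (N + 1 : ℕ) = 0 := by simp [u, h0 (N + 1) (by omega)]
      have e1 := hsum (j - 1)
      have e2 := hsum j
      have e3 : ∀ l : ℕ, φ (-(j - 1)) 0 (J l) * S l (j - 1) =
          u ((l : ℤ) - 1) * S l (j - 1) - u l * (φ (-j) l a * S l (j - 1)) := by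
        intro l
        have : φ (-(j - 1)) 0 (J l) = φ (-j) 0 (φ 1 0 (J l)) := by
          rw [h.add]; ring_nf
        rw [this, hJ']
        simp only [map_sub, map_mul, h.add, u]
        ring_nf
      have e4 : ∀ l : ℕ, φ (-j) 0 (J l) * S l j =
          u ((l : ℤ) - 1) * (φ (-j) (l - 1) b * S l j) + u l * (φ (-j) l c * S l j) := by
        intro l
        simp only [hJ, map_add, map_mul, h.add, u]
        ring_nf
      simp only [e3, Finset.sum_sub_distrib] at e1
      simp only [e4, Finset.sum_add_distrib] at e2
      rw [sum_range_shift (X := fun l => S l (j - 1)) hu1,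
        sum_range_drop (X := fun l => φ (-j) l a * S l (j - 1)) huN] at e1
      rw [sum_range_shift (X := fun l => φ (-j) (l - 1) b * S l j) hu1,
        sum_range_drop (X := fun l => φ (-j) l c * S l j) huN] at e2
      -- The identity (T_i - 1) J = ν L in coordinates: the difference of the vanishing integrals at
      -- j - 1 and j is the ν-weighted sum of the defects of the equation. The defects with l < N
      -- are zero, so the one at l = N is zero too, as ν_N ≠ 0.
      have e5 : ∑ l ∈ Finset.range (N + 1), u l * (S (l + 1) (j - 1) - φ (-j) l b * S (l + 1) j -
          (φ (-j) l a * S l (j - 1) + φ (-j) l c * S l j)) = 0 := by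
        rw [← sub_eq_zero.2 (e1.trans e2.symm)]
        simp only [← Finset.sum_sub_distrib, ← Finset.sum_add_distrib, add_sub_cancel_right]
        refine Finset.sum_congr rfl fun l _ => ?_
        ring
      rw [Finset.sum_range_succ, Finset.sum_eq_zero, zero_add] at e5
      · exact sub_eq_zero.1 ((mul_eq_zero.1 e5).resolve_left (by simpa [u] using hN))
      · intro l hl
        have hl := Finset.mem_range.1 hl
        rw [hS _ _ (by omega), hS _ _ (by omega), hS _ _ (by omega), hS _ _ (by omega),
          hs.2 l j (by omega) (by omega), sub_self, mul_zero]
  have hwide : ∀ k j : ℤ, ¬(0 ≤ j ∧ j < w) → S k j = 0 := by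
    intro k j hj
    by_cases hk : k = N + 1
    · simp only [S, if_pos hk]
      rw [Finset.sum_eq_zero, mul_zero]
      intro l _
      rw [hs.1 l j (by tauto), mul_zero]
    · rw [hS _ _ hk, hs.1 k j (by tauto)]
  -- Rows 1, …, N + 1 are renumbered from 0 and shifted by T_j^{-1}; the cutoff discards the old row
  -- 0, which would land at k = -1.
  refine ⟨fun k j => if 0 ≤ k then φ 0 (-1) (S (k + 1) j) else 0,
    ⟨fun k j hkj => ?_, fun k j hk hkN => ?_⟩, fun j => ?_⟩
  · dsimp only
    split_ifs with hk
    · by_cases hj : 0 ≤ j ∧ j < w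
      · rw [hS _ _ (by omega), hs.1 _ _ (by omega), map_zero]
      · rw [hwide _ _ hj, map_zero]
    · rfl
  · dsimp only
    rw [if_pos (by omega), if_pos (by omega), if_pos hk, if_pos hk]
    have := congrArg (φ 0 (-1)) (hrow (k + 1) j (by omega) (by omega))
    simp only [map_sub, map_add, map_mul, h.add] at this ⊢
    convert this using 2 <;> ring_nf
  · dsimp only
    rw [if_pos le_rfl, if_pos le_rfl, h.add, h.add]
    have := hrow 0 j le_rfl (by omega)
    rw [hS 0 _ (by omega), hS 0 _ (by omega)] at this
    simpa [h.zero] using this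

/-- At the least width of a nonzero solution, a zero at the corner (0, d) would allow narrowing.
Hence a solution is determined by its corner entry. -/
lemma exists_minimal_isStripSolution (φ : ℤ → ℤ → K ≃+* K) (a b c : K) (N : ℕ) :
    ∃ (d : ℕ) (s : ℤ → ℤ → K), IsStripSolution φ a b c N (d + 1) s ∧ s 0 d ≠ 0 ∧
      ∀ t, IsStripSolution φ a b c N (d + 1) t → t 0 d = 0 → t = 0 := by
  classical
  have hex : ∃ w s, s ≠ 0 ∧ IsStripSolution φ a b c N w s :=
    ⟨_, exists_isStripSolution φ a b c N⟩
  obtain ⟨s, hs0, hs⟩ := Nat.find_spec hex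
  cases hw : Nat.find hex with
  | zero =>
    rw [hw] at hs
    exact absurd (funext fun k => funext fun j => hs.1 k j (by omega)) hs0
  | succ d =>
    have hmin : ∀ t, IsStripSolution φ a b c N (d + 1) t → t 0 d = 0 → t = 0 := by
      intro t ht htd
      by_contra ht0
      exact Nat.find_min hex (m := d) (by omega) ⟨t, ht0, ht.narrow htd⟩
    rw [hw] at hs
    exact ⟨d, s, hs, fun h => hs0 (hmin s hs h), hmin⟩

end Strip

/-! ### Integrals give drivers, and the converse by adjunction. -/

/-- Formal integrals in both directions give rise to a symmetry driver. -/
theorem driverCoeffs_of_integralCoeffs {φ : ℤ → ℤ → K ≃+* K} (h : IsLatticeAction φ) {a b c : K}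
    (hb : b ≠ 0) (hI : IntegralCoeffs φ a b c)
    (hJ : IntegralCoeffs (fun p q => φ q p) b a c) : DriverCoeffs φ a b c := by
  obtain ⟨g, hg, hga⟩ := hI.exists_gauge h
  obtain ⟨ν, N, hN, h0, he⟩ := hJ.normalize h.swap
  obtain ⟨d, s, hs, hsd, hmin⟩ := exists_minimal_isStripSolution φ a b c N
  obtain ⟨t, ht, hst⟩ := hs.exists_next h hb hN h0 he
  set f : ℤ → K := s 0
  have hf0 : ∀ j : ℤ, ¬(0 ≤ j ∧ j ≤ d) → f j = 0 := fun j hj => hs.1 0 j (by push_cast; omega)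
  have ht0 : ∀ j, t 0 j = t 0 d / f d * f j := by
    intro j
    have h1 := hmin _ (hs.sub_smul ht (t 0 d / f d)) (by
      change t 0 d - t 0 d / f d * f d = 0
      field_simp
      ring)
    exact sub_eq_zero.1 (congrFun (congrFun h1 0) j)
  -- Row 0 of the new strip is proportional to f, so f satisfies the driver relation with T_j
  -- replaced by y T_j.
  set y : K := φ 0 1 (t 0 d / f d) with hy
  have hrow : ∀ j, y * φ 0 1 (f (j - 1)) - φ (-j) 0 b * (y * φ 0 1 (f j)) =
      φ (-j) 0 a * f (j - 1) + φ (-j) 0 c * f j := by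
    intro j
    have := hst j
    rwa [ht0 (j - 1), ht0 j, map_mul, map_mul, ← hy] at this
  have htop : y * φ 0 1 (f d) = φ (-(d + 1)) 0 a * f d := by
    have := hrow (d + 1)
    rw [hf0 (d + 1) (by omega), add_sub_cancel_right] at this
    simpa using this
  -- The top relation `htop` shows that y is T_i^{-(d+1)}(a) times f_d / T_j(f_d), while g satisfies
  -- g = T_j(g) a. The product k is therefore fixed by y T_j, and division by k reduces y to 1.
  set k : K := f d * φ (-(d + 1)) 0 g with hk
  have hk0 : k ≠ 0 := mul_ne_zero hsd (by simpa using hg)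
  have hyk : y * φ 0 1 k = k := by
    rw [hk, map_mul, ← mul_assoc, htop, h.add]
    have := congrArg (φ (-(d + 1)) 0) hga
    rw [map_mul, h.add] at this
    conv_rhs => rw [this]
    simp only [zero_add, add_zero]
    ring
  have hyk' : φ 0 1 k ≠ 0 := by simpa using hk0
  refine ⟨fun j => φ j 0 (f j / k), ?_, ?_, fun j => ?_⟩
  · refine (Set.finite_Icc (0 : ℤ) d).subset fun j hj => ?_
    by_contra hj'
    exact hj (by simp [hf0 j (by simpa using hj')])
  · refine Function.ne_iff.2 ⟨d, ?_⟩
    simpa [hk0] using hsd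
  · have h1 : φ 0 1 (f (j - 1) / k) - φ (-j) 0 b * φ 0 1 (f j / k) =
        φ (-j) 0 a * (f (j - 1) / k) + φ (-j) 0 c * (f j / k) := by
      have hd : ∀ x, φ 0 1 (x / k) = y * φ 0 1 x / k := by
        intro x
        rw [map_div₀, div_eq_div_iff hyk' hk0]
        linear_combination -(φ 0 1 x) * hyk
      rw [hd, hd]
      have := hrow j
      field_simp
      linear_combination this
    have := congrArg (φ j 0) h1
    simp only [map_sub, map_add, map_mul, h.add] at this ⊢
    simpa [h.zero] using this

/-- Formal integrals exist in both directions if and only if symmetry drivers do. -/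
theorem integralCoeffs_iff_driverCoeffs {φ : ℤ → ℤ → K ≃+* K} (h : IsLatticeAction φ) {a b c : K}
    (ha : a ≠ 0) (hb : b ≠ 0) :
    (IntegralCoeffs φ a b c ∧ IntegralCoeffs (fun p q => φ q p) b a c) ↔
      (DriverCoeffs φ a b c ∧ DriverCoeffs (fun p q => φ q p) b a c) := by
  constructor
  · rintro ⟨hI, hJ⟩
    exact ⟨driverCoeffs_of_integralCoeffs h hb hI hJ,
      driverCoeffs_of_integralCoeffs h.swap ha hJ hI⟩
  · rintro ⟨hR, hR'⟩
    have hI := (driverCoeffs_iff_adjoint h a b c).1 hR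
    have hJ := (driverCoeffs_iff_adjoint h.swap b a c).1 hR'
    have ha' : φ (-1) 0 a ≠ 0 := by simpa using ha
    have hb' : φ 0 (-1) b ≠ 0 := by simpa using hb
    -- The forward implication is applied to the adjoint equation; a second adjunction restores the
    -- original action and coefficients.
    have h1 := (driverCoeffs_iff_adjoint h.neg _ _ _).1
      (driverCoeffs_of_integralCoeffs h.neg hb' hI hJ)
    have h2 := (driverCoeffs_iff_adjoint h.neg.swap _ _ _).1
      (driverCoeffs_of_integralCoeffs h.neg.swap ha' hJ hI)
    simp only [neg_neg, neg_zero, h.add, add_neg_cancel, add_zero, h.zero] at h1 h2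
    exact ⟨h1, h2⟩

end Coefficients

end QuadGraph

noncomputable section

open scoped Topology ContDiff

namespace QuadGraph

/-! ### The action of the shifts on the field of functions. -/

namespace SolutionSpace

variable {𝕜 : Type*} [RCLike 𝕜] {E : Equation 𝕜} (Ω : SolutionSpace E)

lemma ofTriple_ne_zero {G : 𝕜 × 𝕜 × 𝕜 → 𝕜} (hG : AnalyticOnNhd 𝕜 G E.dom)
    (h : ∀ p ∈ E.dom, G p ≠ 0) : Ω.ofTriple G hG ≠ 0 := by
  obtain ⟨_, u, hu, _⟩ := (Ω.isConnected_dynVars 0).nonempty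
  unfold ofTriple
  rw [Ne, IsFractionRing.to_map_eq_zero_iff]
  intro h0
  exact h _ (Ω.isSolution u hu 0).1 (congrFun (congrArg Subtype.val h0) ⟨u, hu⟩)

lemma shift_algebraMap (v : ℤ × ℤ) (g : Ω.analyticRing) :
    Ω.shift v (algebraMap _ Ω.FunField g) = algebraMap _ Ω.FunField (Ω.shiftAnalytic v g) :=
  IsFractionRing.ringEquivOfRingEquiv_algebraMap _ _

lemma shift_div (v : ℤ × ℤ) (g h : Ω.analyticRing) :
    Ω.shift v (algebraMap _ Ω.FunField g / algebraMap _ Ω.FunField h) =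
      algebraMap _ Ω.FunField (Ω.shiftAnalytic v g) /
        algebraMap _ Ω.FunField (Ω.shiftAnalytic v h) := by
  rw [map_div₀, shift_algebraMap, shift_algebraMap]

lemma shift_zero (x : Ω.FunField) : Ω.shift 0 x = x := by
  obtain ⟨g, h, _, rfl⟩ := IsFractionRing.div_surjective (A := Ω.analyticRing) x
  have key : ∀ g, Ω.shiftAnalytic 0 g = g := by
    intro g
    apply Subtype.ext
    funext u
    refine congrArg g.1 (Subtype.ext (funext fun s => ?_))
    simp [translateSol, translate]
  rw [shift_div, key, key]

lemma shift_shift (v w : ℤ × ℤ) (x : Ω.FunField) :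
    Ω.shift v (Ω.shift w x) = Ω.shift (v + w) x := by
  obtain ⟨g, h, _, rfl⟩ := IsFractionRing.div_surjective (A := Ω.analyticRing) x
  have key : ∀ g, Ω.shiftAnalytic v (Ω.shiftAnalytic w g) = Ω.shiftAnalytic (v + w) g := by
    intro g
    apply Subtype.ext
    funext u
    refine congrArg g.1 (Subtype.ext (funext fun s => ?_))
    simp only [translateSol, translate, add_assoc, add_comm v w]
  rw [shift_div, shift_div, shift_div, key, key]

/-- The action of `ℤ × ℤ` on the field of functions, with respect to the directions `e`, `e'`. -/
def shiftAction (e e' : ℤ × ℤ) (p q : ℤ) : Ω.FunField ≃+* Ω.FunField :=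
  Ω.shift (p • e + q • e')

lemma isLatticeAction_shiftAction (e e' : ℤ × ℤ) : IsLatticeAction (Ω.shiftAction e e') where
  zero x := by simp [shiftAction, shift_zero]
  add p q p' q' x := by
    simp only [shiftAction, shift_shift]
    congr 2
    module

lemma swap_shiftAction (e e' : ℤ × ℤ) :
    (fun p q => Ω.shiftAction e e' q p) = Ω.shiftAction e' e := by
  funext p q
  simp only [shiftAction, add_comm]

lemma operator_sum_apply {ι : Type*} (t : Finset ι) (A : ι → Ω.Operator) (f : Ω.LatticeFun) :
    (∑ k ∈ t, A k) f = ∑ k ∈ t, A k f :=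
  map_sum (AddMonoidHom.eval f : (Ω.LatticeFun →+ Ω.LatticeFun) →+ Ω.LatticeFun) A t

/-! ### Stability of dependence on finitely many dynamical variables. -/

section DependsOn

variable {Ω}

lemma DependsOn.mono {N M : ℕ} (h : N ≤ M) {g : Ω.FunField} (hg : Ω.DependsOn N g) :
    Ω.DependsOn M g := by
  obtain ⟨a, b, ha, hb, hb0, rfl⟩ := hg
  exact ⟨a, b, Ω.analyticFun_mono h ha, Ω.analyticFun_mono h hb, hb0, rfl⟩

lemma exists_dependsOn (g : Ω.FunField) : ∃ N, Ω.DependsOn N g := by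
  obtain ⟨a, b, hb, rfl⟩ := IsFractionRing.div_surjective (A := Ω.analyticRing) g
  obtain ⟨N, ha⟩ := a.2
  obtain ⟨M, hb'⟩ := b.2
  exact ⟨max N M, a, b, Ω.analyticFun_mono (le_max_left _ _) ha,
    Ω.analyticFun_mono (le_max_right _ _) hb', nonZeroDivisors.ne_zero hb, rfl⟩

lemma DependsOn.add {N : ℕ} {g h : Ω.FunField} (hg : Ω.DependsOn N g) (hh : Ω.DependsOn N h) :
    Ω.DependsOn N (g + h) := by
  obtain ⟨a, b, ha, hb, hb0, rfl⟩ := hg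
  obtain ⟨a', b', ha', hb', hb0', rfl⟩ := hh
  refine ⟨a * b' + b * a', b * b', add_mem (mul_mem ha hb') (mul_mem hb ha'), mul_mem hb hb',
    mul_ne_zero hb0 hb0', ?_⟩
  rw [map_add, map_mul, map_mul, map_mul]
  refine div_add_div _ _ ?_ ?_ <;> rwa [Ne, IsFractionRing.to_map_eq_zero_iff]

lemma DependsOn.mul {N : ℕ} {g h : Ω.FunField} (hg : Ω.DependsOn N g) (hh : Ω.DependsOn N h) :
    Ω.DependsOn N (g * h) := by
  obtain ⟨a, b, ha, hb, hb0, rfl⟩ := hg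
  obtain ⟨a', b', ha', hb', hb0', rfl⟩ := hh
  refine ⟨a * a', b * b', mul_mem ha ha', mul_mem hb hb', mul_ne_zero hb0 hb0', ?_⟩
  rw [map_mul, map_mul, div_mul_div_comm]

lemma DependsOn.shift {N : ℕ} {g : Ω.FunField} (hg : Ω.DependsOn N g) (v : ℤ × ℤ) :
    Ω.DependsOn (N + v.1.natAbs + v.2.natAbs) (Ω.shift v g) := by
  obtain ⟨a, b, ha, hb, hb0, rfl⟩ := hg
  exact ⟨Ω.shiftAnalytic v a, Ω.shiftAnalytic v b, Ω.comp_translateSol_mem v ha,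
    Ω.comp_translateSol_mem v hb, by simpa using hb0, Ω.shift_div v a b⟩

lemma dependsOn_zero (N : ℕ) : Ω.DependsOn N 0 :=
  ⟨0, 1, zero_mem _, one_mem _, one_ne_zero, by simp⟩

lemma dependsOn_one (N : ℕ) : Ω.DependsOn N 1 :=
  ⟨1, 1, one_mem _, one_mem _, one_ne_zero, by simp⟩

lemma isFun_zero : Ω.IsFun 0 := ⟨0, fun _ => dependsOn_zero 0⟩

lemma IsFun.add {f g : Ω.LatticeFun} (hf : Ω.IsFun f) (hg : Ω.IsFun g) : Ω.IsFun (f + g) := by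
  obtain ⟨N, hf⟩ := hf
  obtain ⟨M, hg⟩ := hg
  exact ⟨max N M, fun s => ((hf s).mono (le_max_left _ _)).add ((hg s).mono (le_max_right _ _))⟩

lemma IsFun.mulOp {f : Ω.LatticeFun} (hf : Ω.IsFun f) (g : Ω.FunField) :
    Ω.IsFun (Ω.mulOp g f) := by
  obtain ⟨N, hf⟩ := hf
  obtain ⟨M, hg⟩ := exists_dependsOn g
  exact ⟨max N M, fun s => (hg.mono (le_max_right _ _)).mul ((hf s).mono (le_max_left _ _))⟩

lemma IsFun.T_pow {f : Ω.LatticeFun} (hf : Ω.IsFun f) (v : ℤ × ℤ) (k : ℕ) :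
    Ω.IsFun ((Ω.T v ^ k) f) := by
  induction k with
  | zero => exact hf
  | succ k ih =>
    obtain ⟨N, ih⟩ := ih
    rw [pow_succ']
    exact ⟨_, fun s => (ih (s + v)).shift v⟩

lemma IsFun.polyOp {f : Ω.LatticeFun} (hf : Ω.IsFun f) (v : ℤ × ℤ) (r : ℕ)
    (c : ℕ → Ω.FunField) : Ω.IsFun (Ω.polyOp (Ω.T v) r c f) := by
  have : Ω.polyOp (Ω.T v) r c f =
      ∑ k ∈ Finset.range (r + 1), Ω.mulOp (c k) ((Ω.T v ^ k) f) :=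
    Ω.operator_sum_apply _ _ f
  rw [this]
  exact Finset.sum_induction _ Ω.IsFun (fun _ _ => IsFun.add) isFun_zero
    fun k _ => (hf.T_pow v k).mulOp _

end DependsOn

/-! ### Values of the operators at a lattice point. -/

lemma T_apply (v : ℤ × ℤ) (f : Ω.LatticeFun) (s : ℤ × ℤ) :
    Ω.T v f s = Ω.shift v (f (s + v)) := rfl

lemma T_pow_apply (v : ℤ × ℤ) (k : ℕ) (f : Ω.LatticeFun) (s : ℤ × ℤ) :
    (Ω.T v ^ k) f s = Ω.shift ((k : ℤ) • v) (f (s + (k : ℤ) • v)) := by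
  induction k generalizing s with
  | zero => simp [shift_zero]
  | succ k ih =>
    rw [pow_succ']
    change Ω.shift v ((Ω.T v ^ k) f (s + v)) = _
    rw [ih, shift_shift]
    have : v + (k : ℤ) • v = ((k + 1 : ℕ) : ℤ) • v := by push_cast; module
    rw [add_assoc, this]

lemma polyOp_apply (v : ℤ × ℤ) (r : ℕ) (c : ℕ → Ω.FunField) (f : Ω.LatticeFun) (s : ℤ × ℤ) :
    Ω.polyOp (Ω.T v) r c f s = ∑ k ∈ Finset.range (r + 1),
      c k * Ω.shift ((k : ℤ) • v) (f (s + (k : ℤ) • v)) := by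
  rw [SolutionSpace.polyOp, operator_sum_apply, Finset.sum_apply]
  refine Finset.sum_congr rfl fun k _ => ?_
  rw [← T_pow_apply]
  rfl

/-- The linearization operator in terms of the directions `e`, `e'`. -/
def IsLinearization (e e' : ℤ × ℤ) (a b c : Ω.FunField) : Prop :=
  ∀ f s, Ω.L f s = Ω.shift (e + e') (f (s + (e + e'))) - a * Ω.shift e (f (s + e)) -
    b * Ω.shift e' (f (s + e')) - c * f s

lemma isLinearization : Ω.IsLinearization (1, 0) (0, 1) Ω.Fu10 Ω.Fu01 Ω.Fu := by
  intro f s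
  rw [← shift_shift, ← add_assoc]
  rfl

lemma isLinearization_swap : Ω.IsLinearization (0, 1) (1, 0) Ω.Fu01 Ω.Fu10 Ω.Fu := by
  intro f s
  rw [isLinearization, add_comm (0, 1)]
  ring

/-! ### From operators to coefficient relations, for either choice of direction. -/

section Directions

variable {e e' : ℤ × ℤ} {a b c : Ω.FunField}

lemma integral_left_apply (M : ℕ) (μ : ℕ → Ω.FunField) (f : Ω.LatticeFun) (s : ℤ × ℤ) :
    ((Ω.T e' - 1) * Ω.polyOp (Ω.T e) M μ) f s = ∑ k ∈ Finset.range (M + 1),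
      (Ω.shiftAction e e' 0 1 (μ k) * Ω.shift ((k : ℤ) • e + e') (f (s + ((k : ℤ) • e + e'))) -
        μ k * Ω.shift ((k : ℤ) • e) (f (s + (k : ℤ) • e))) := by
  change Ω.shift e' (Ω.polyOp (Ω.T e) M μ f (s + e')) - Ω.polyOp (Ω.T e) M μ f s = _
  rw [polyOp_apply, polyOp_apply, map_sum, ← Finset.sum_sub_distrib]
  refine Finset.sum_congr rfl fun k _ => ?_
  rw [map_mul, shift_shift, add_assoc, add_comm e']
  simp [shiftAction]

lemma integral_right_apply (hL : Ω.IsLinearization e e' a b c) (N : ℕ) (ν : ℕ → Ω.FunField)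
    (f : Ω.LatticeFun) (s : ℤ × ℤ) :
    (Ω.polyOp (Ω.T e) N ν * Ω.L) f s = ∑ k ∈ Finset.range (N + 1),
      ν k * (Ω.shift (((k : ℤ) + 1) • e + e') (f (s + (((k : ℤ) + 1) • e + e'))) -
        Ω.shiftAction e e' k 0 a * Ω.shift (((k : ℤ) + 1) • e) (f (s + ((k : ℤ) + 1) • e)) -
        Ω.shiftAction e e' k 0 b * Ω.shift ((k : ℤ) • e + e') (f (s + ((k : ℤ) • e + e'))) -
        Ω.shiftAction e e' k 0 c * Ω.shift ((k : ℤ) • e) (f (s + (k : ℤ) • e))) := by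
  change Ω.polyOp (Ω.T e) N ν (Ω.L f) s = _
  rw [polyOp_apply]
  refine Finset.sum_congr rfl fun k _ => ?_
  have h1 : (k : ℤ) • e + (e + e') = ((k : ℤ) + 1) • e + e' := by module
  have h2 : (k : ℤ) • e + e = ((k : ℤ) + 1) • e := by module
  rw [hL]
  simp only [map_sub, map_mul, shift_shift, add_assoc, h1, h2, shiftAction, zero_smul, add_zero]

/-- The coefficients of `N L` in terms of those of `N`. -/
lemma sum_integral_right {K : Type*} [Field K] (φ : ℤ → ℤ → K ≃+* K) (a b c : K) {N : ℕ}
    {n : ℤ → K} (h0 : ∀ k : ℤ, ¬(0 ≤ k ∧ k ≤ N) → n k = 0) (X Y : ℤ → K) :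
    ∑ k ∈ Finset.range (N + 1), n k * (X (k + 1) - φ k 0 a * Y (k + 1) - φ k 0 b * X k -
        φ k 0 c * Y k) =
      ∑ k ∈ Finset.range (N + 2), ((n (k - 1) - n k * φ k 0 b) * X k -
        (n (k - 1) * φ (k - 1) 0 a + n k * φ k 0 c) * Y k) := by
  have h1 : n (-1) = 0 := h0 _ (by omega)
  have h2 : n (N + 1 : ℕ) = 0 := h0 _ (by omega)
  have e1 := sum_range_shift (X := X) (M := N + 1) h1
  have e2 := sum_range_shift (X := fun k => φ (k - 1) 0 a * Y k) (M := N + 1) h1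
  have e3 := sum_range_drop (X := fun k => φ k 0 b * X k) h2
  have e4 := sum_range_drop (X := fun k => φ k 0 c * Y k) h2
  simp only [sub_mul, add_mul, mul_sub, Finset.sum_sub_distrib, Finset.sum_add_distrib, mul_assoc,
    add_sub_cancel_right] at *
  rw [e1, e2, e3, e4]
  ring

lemma coeff_eq_zero {K : Type*} [Field K] {M : ℕ} {c : ℤ → K}
    (h : ∀ X : ℤ → K, ∑ k ∈ Finset.range M, c k * X k = 0) (k : ℕ) (hk : k < M) : c k = 0 := by
  have := h (Pi.single k 1)
  rw [Finset.sum_eq_single k] at this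
  · simpa using this
  · intro l _ hl
    rw [Pi.single_eq_of_ne (by exact_mod_cast hl), mul_zero]
  · intro h'
    exact absurd (Finset.mem_range.2 hk) h'

variable {κ κ' : ℤ × ℤ →+ ℤ}

/-- The functionals κ, κ' are the coordinates along e, e'. The operator identity is tested on
arbitrary families, so the coefficients of T_e^k and T_e^k T_{e'} can be compared separately;
eliminating μ between the two comparisons leaves the relation for ν. -/
lemma formalIntegral_iff (hκe : κ e = 1) (hκe' : κ e' = 0) (hκ'e : κ' e = 0) (hκ'e' : κ' e' = 1)
    (ha : a ≠ 0) (hL : Ω.IsLinearization e e' a b c) :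
    (∃ m μ, Ω.IsFormalIntegral (Ω.T e) (Ω.T e') m μ) ↔
      IntegralCoeffs (Ω.shiftAction e e') a b c := by
  have hφ := Ω.isLatticeAction_shiftAction e e'
  constructor
  · rintro ⟨m, μ, hm, hμ, ν, hν⟩
    obtain ⟨N, rfl⟩ := Nat.exists_eq_add_of_lt hm
    simp only [zero_add, Nat.add_sub_cancel] at hν hμ
    let n : ℤ → Ω.FunField := fun k => if 0 ≤ k ∧ k ≤ N then ν k.toNat else 0
    let m : ℤ → Ω.FunField := fun k => μ k.toNat
    have h0 : ∀ k : ℤ, ¬(0 ≤ k ∧ k ≤ N) → n k = 0 := fun k hk => if_neg hk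
    have hn : ∀ k ∈ Finset.range (N + 1), ν k = n k := by
      intro k hk
      have := Finset.mem_range.1 hk
      simp only [n]
      rw [if_pos (by omega), Int.toNat_natCast]
    have key : ∀ X Y : ℤ → Ω.FunField, ∑ k ∈ Finset.range (N + 2),
        (Ω.shiftAction e e' 0 1 (m k) * X k - m k * Y k) = ∑ k ∈ Finset.range (N + 2),
        ((n (k - 1) - n k * Ω.shiftAction e e' k 0 b) * X k -
        (n (k - 1) * Ω.shiftAction e e' (k - 1) 0 a + n k * Ω.shiftAction e e' k 0 c) * Y k) := by
      intro X Y
      -- The inverse shift makes the shifted values of f at k e and k e + e' equal to the prescribed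
      -- Y k and X k.
      let f : Ω.LatticeFun := fun s => (Ω.shift s).symm (if κ' s = 0 then Y (κ s) else X (κ s))
      have h1 := congrFun (DFunLike.congr_fun hν f) 0
      rw [integral_left_apply, Ω.integral_right_apply hL] at h1
      have hY : ∀ k : ℤ, Ω.shift (k • e) (f (0 + k • e)) = Y k := by
        intro k
        rw [zero_add]
        simp only [f, map_zsmul, hκe, hκ'e, mul_zero, if_true, smul_eq_mul, mul_one,
          RingEquiv.apply_symm_apply]
      have hX : ∀ k : ℤ, Ω.shift (k • e + e') (f (0 + (k • e + e'))) = X k := by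
        intro k
        rw [zero_add]
        simp only [f, map_add, map_zsmul, hκe, hκ'e, hκe', hκ'e', mul_zero, zero_add, add_zero,
          one_ne_zero, if_false, smul_eq_mul, mul_one, RingEquiv.apply_symm_apply]
      simp only [hX, hY] at h1
      rw [← sum_integral_right _ a b c h0 X Y]
      refine Eq.trans ?_ (h1.trans (Finset.sum_congr rfl fun k hk => by rw [hn k hk]))
      simp only [m, Int.toNat_natCast]
    have hc1 := coeff_eq_zero (M := N + 2)
      (c := fun k => Ω.shiftAction e e' 0 1 (m k) - (n (k - 1) - n k * Ω.shiftAction e e' k 0 b))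
      (by
        intro X
        have := key X 0
        simp only [Pi.zero_apply, mul_zero, sub_zero] at this
        simp only [sub_mul _ _ (X _)] at this ⊢
        rw [Finset.sum_sub_distrib, this]
        simp [Finset.sum_sub_distrib])
    have hc2 := coeff_eq_zero (M := N + 2)
      (c := fun k => m k - (n (k - 1) * Ω.shiftAction e e' (k - 1) 0 a +
        n k * Ω.shiftAction e e' k 0 c))
      (by
        intro Y
        have := key 0 Y
        simp only [Pi.zero_apply, mul_zero, zero_sub, Finset.sum_neg_distrib, neg_inj] at this
        simp only [sub_mul]
        rw [Finset.sum_sub_distrib, this, sub_self])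
    refine ⟨n, ?_, ?_, fun k => ?_⟩
    · refine (Set.finite_Icc (0 : ℤ) N).subset fun j hj => ?_
      by_contra hj'
      exact hj (h0 j (by simpa using hj'))
    · intro hn0
      have := hc1 (N + 1) (by omega)
      simp only [hn0, Pi.zero_apply, zero_mul, sub_zero, map_eq_zero_iff _
        (RingEquiv.injective _)] at this
      exact hμ (by simpa [m] using this)
    · by_cases hk : 0 ≤ k ∧ k < N + 2
      · obtain ⟨hk, hk'⟩ := hk
        lift k to ℕ using hk
        rw [← sub_eq_zero.1 (hc1 k (by omega)), sub_eq_zero.1 (hc2 k (by omega))]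
        simp [hφ.add]
      · rw [h0 k (by omega), h0 (k - 1) (by omega)]
        simp
  · intro hI
    obtain ⟨n, N, hN, h0, he⟩ := hI.normalize hφ
    -- These μ_k are forced by the coefficients of T_e^k. The leading one is n_N T_e^N(a), nonzero
    -- because a is.
    refine ⟨N + 1, fun k => n (k - 1) * Ω.shiftAction e e' (k - 1) 0 a +
      n k * Ω.shiftAction e e' k 0 c, by omega, ?_, fun k => n k, ?_⟩
    · have h1 : n ((N : ℤ) + 1) = 0 := h0 _ (by omega)
      simp [h1, hN, ha]
    · refine DFunLike.ext (F := Ω.Operator) _ _ fun f => funext fun s => ?_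
      rw [integral_left_apply, Ω.integral_right_apply hL, Nat.add_sub_cancel]
      refine Eq.trans ?_ (sum_integral_right (Ω.shiftAction e e') a b c h0
        (fun k => Ω.shift (k • e + e') (f (s + (k • e + e'))))
        (fun k => Ω.shift (k • e) (f (s + k • e)))).symm
      refine Finset.sum_congr rfl fun k _ => ?_
      rw [he k]
      simp [hφ.add]

/-- Since ξ is fixed by T_{e'}, every shift of ξ along e' can be removed, and only the functions
T_e^k(ξ) remain. -/
lemma linearization_driver_apply (hL : Ω.IsLinearization e e' a b c) {N : ℕ}
    {r : ℤ → Ω.FunField} (h0 : ∀ k : ℤ, ¬(0 ≤ k ∧ k ≤ N) → r k = 0) {ξ : Ω.LatticeFun}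
    (hξ : ∀ s, Ω.shift e' (ξ (s + e')) = ξ s) (s : ℤ × ℤ) :
    Ω.L (Ω.polyOp (Ω.T e) N (fun k => r k) ξ) s = ∑ k ∈ Finset.range (N + 2),
      (Ω.shiftAction e e' 1 1 (r (k - 1)) - a * Ω.shiftAction e e' 1 0 (r (k - 1)) -
        b * Ω.shiftAction e e' 0 1 (r k) - c * r k) *
          Ω.shift ((k : ℤ) • e) (ξ (s + (k : ℤ) • e)) := by
  set Y : ℤ → Ω.FunField := fun k => Ω.shift (k • e) (ξ (s + k • e)) with hY
  have h1 : r (-1) = 0 := h0 _ (by omega)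
  have h2 : r (N + 1 : ℕ) = 0 := h0 _ (by omega)
  have e1 := sum_range_shift (u := fun k => Ω.shiftAction e e' 1 1 (r k)) (X := Y) (M := N + 1)
    (by simp [h1])
  have e2 := sum_range_shift (u := fun k => a * Ω.shiftAction e e' 1 0 (r k)) (X := Y)
    (M := N + 1) (by simp [h1])
  have e3 := sum_range_drop (u := fun k => b * Ω.shiftAction e e' 0 1 (r k)) (X := Y)
    (M := N + 1) (by rw [h2]; simp)
  have e4 := sum_range_drop (u := fun k => c * r k) (X := Y) (M := N + 1) (by rw [h2]; simp)
  have f1 : ∀ k : ℤ, Ω.shift (e + k • e) (ξ (s + e + k • e)) = Y (k + 1) := by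
    intro k
    have : e + k • e = (k + 1) • e := by module
    rw [add_assoc, this]
  have f2 : ∀ k : ℤ, Ω.shift (e' + k • e) (ξ (s + e' + k • e)) = Y k := by
    intro k
    rw [add_comm e', ← shift_shift, add_right_comm, hξ]
  have f3 : ∀ k : ℤ, Ω.shift (e + e' + k • e) (ξ (s + (e + e') + k • e)) = Y (k + 1) := by
    intro k
    have h3 : e + e' + k • e = (k + 1) • e + e' := by module
    rw [add_assoc s, h3, ← shift_shift, ← add_assoc, hξ]
  simp only [sub_mul, Finset.sum_sub_distrib]
  rw [e1, e2, e3, e4, hL]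
  simp only [polyOp_apply, map_sum, map_mul, shift_shift, f1, f2, f3, Finset.mul_sum, mul_assoc]
  simp [shiftAction, hY]

lemma symmetryDriver_iff (hκe : κ e = 1) (hκe' : κ e' = 0)
    (hL : Ω.IsLinearization e e' a b c) :
    (∃ r lam, Ω.IsSymmetryDriver (Ω.T e) (Ω.T e') r lam) ↔
      DriverCoeffs (Ω.shiftAction e e') a b c := by
  constructor
  · rintro ⟨N, lam, hlam, hsym⟩
    let r : ℤ → Ω.FunField := fun k => if 0 ≤ k ∧ k ≤ N then lam k.toNat else 0
    have h0 : ∀ k : ℤ, ¬(0 ≤ k ∧ k ≤ N) → r k = 0 := fun k hk => if_neg hk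
    have hr : ∀ k ∈ Finset.range (N + 1), lam k = r k := by
      intro k hk
      have := Finset.mem_range.1 hk
      simp only [r]
      rw [if_pos (by omega), Int.toNat_natCast]
    have hpoly : Ω.polyOp (Ω.T e) N lam = Ω.polyOp (Ω.T e) N (fun k => r k) :=
      Finset.sum_congr rfl fun k hk => by rw [hr k hk]
    have hc : ∀ k : ℕ, k < N + 2 → Ω.shiftAction e e' 1 1 (r (k - 1)) -
        a * Ω.shiftAction e e' 1 0 (r (k - 1)) - b * Ω.shiftAction e e' 0 1 (r k) - c * r k = 0 := by
      intro k hk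
      -- The explicit dependence of ξ on the lattice point is what separates the coefficients: this
      -- indicator is constant along e' and isolates the k-th term at the origin.
      let ξ : Ω.LatticeFun := fun s => if κ s = k then 1 else 0
      have hξ : ∀ s, Ω.shift e' (ξ (s + e')) = ξ s := by
        intro s
        simp only [ξ, map_add, hκe', add_zero]
        split_ifs <;> simp
      have hfun : Ω.IsFun ξ := by
        refine ⟨0, fun s => ?_⟩
        simp only [ξ]
        split_ifs
        · exact dependsOn_one 0
        · exact dependsOn_zero 0
      have h1 := (hsym ξ hfun (funext fun s => sub_eq_zero.2 (hξ s))).2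
      rw [hpoly] at h1
      have h2 := congrFun h1 0
      rw [Ω.linearization_driver_apply hL h0 hξ, Finset.sum_eq_single k] at h2
      · have : ξ (0 + (k : ℤ) • e) = 1 := if_pos (by rw [zero_add, map_zsmul, hκe]; simp)
        rwa [this, map_one, mul_one] at h2
      · intro l _ hl
        have : ξ (0 + (l : ℤ) • e) = 0 := if_neg (by
          rw [zero_add, map_zsmul, hκe]
          simpa using hl)
        rw [this, map_zero, mul_zero]
      · intro h'
        exact absurd (Finset.mem_range.2 hk) h'
    refine ⟨r, ?_, ?_, fun k => ?_⟩
    · refine (Set.finite_Icc (0 : ℤ) N).subset fun j hj => ?_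
      by_contra hj'
      exact hj (h0 j (by simpa using hj'))
    · intro hr0
      exact hlam (by rw [hr N (by simp), hr0, Pi.zero_apply])
    · by_cases hk : 0 ≤ k ∧ k < N + 2
      · obtain ⟨hk, hk'⟩ := hk
        lift k to ℕ using hk
        linear_combination hc k (by omega)
      · rw [h0 k (by omega), h0 (k - 1) (by omega)]
        simp
  · intro hD
    obtain ⟨r, N, hN, h0, he⟩ := hD.normalize
    refine ⟨N, fun k => r k, hN, fun ξ hfun hξ => ⟨hfun.polyOp _ _ _, funext fun s => ?_⟩⟩
    rw [Ω.linearization_driver_apply hL h0 fun s => sub_eq_zero.1 (congrFun hξ s)]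
    refine Finset.sum_eq_zero fun k _ => ?_
    rw [mul_eq_zero]
    left
    linear_combination he k

end Directions

end SolutionSpace

end QuadGraph

end

theorem mainTheorem3 {𝕜 : Type*} [RCLike 𝕜] (E : QuadGraph.Equation 𝕜)
    (Ω : QuadGraph.SolutionSpace E) :
    (Ω.HasFormalIIntegral ∧ Ω.HasFormalJIntegral) ↔
      (Ω.HasISymmetryDriver ∧ Ω.HasJSymmetryDriver) := by
  have ha : Ω.Fu10 ≠ 0 := Ω.ofTriple_ne_zero _ E.partialU10_ne_zero
  have hb : Ω.Fu01 ≠ 0 := Ω.ofTriple_ne_zero _ E.partialU01_ne_zero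
  have h := QuadGraph.integralCoeffs_iff_driverCoeffs
    (Ω.isLatticeAction_shiftAction (1, 0) (0, 1)) (c := Ω.Fu) ha hb
  rw [Ω.swap_shiftAction] at h
  have h1 := Ω.formalIntegral_iff (κ := AddMonoidHom.fst ℤ ℤ) (κ' := AddMonoidHom.snd ℤ ℤ)
    rfl rfl rfl rfl ha Ω.isLinearization
  have h2 := Ω.formalIntegral_iff (κ := AddMonoidHom.snd ℤ ℤ) (κ' := AddMonoidHom.fst ℤ ℤ)
    rfl rfl rfl rfl hb Ω.isLinearization_swap
  have h3 := Ω.symmetryDriver_iff (κ := AddMonoidHom.fst ℤ ℤ) rfl rfl Ω.isLinearization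
  have h4 := Ω.symmetryDriver_iff (κ := AddMonoidHom.snd ℤ ℤ) rfl rfl Ω.isLinearization_swap
  rw [← h1, ← h2, ← h3, ← h4] at h
  exact h
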